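/- Let $K$ be a field and let $M\subset\mathbb Z^d$ be a positive normal affine monoid with $\operatorname{gp}(M)=\mathbb Z^d$; that is, $M$ is finitely generated and generates $\mathbb Z^d$ as a group, $nx\in M$ for some $x\in\mathbb Z^d$ and some integer $n\ge 1$ implies $x\in M$, and $0$ is the only invertible element of $M$. Let $\sigma_1,\dots,\sigma_s$ be the primitive integral linear forms on $\mathbb R^d$ (primitive: the values on the canonical basis are coprime) for which $\mathbb R_+M=\{x\in\mathbb R^d:\sigma_i(x)\ge 0,\ i=1,\dots,s\}$ is an irredundant representation of the cone generated by $M$, and put $\sigma=(\sigma_1,\dots,\sigma_s):\mathbb R^d\to\mathbb R^s$. Let $R=K[M]$, let $\operatorname{Cl}(R)$ be its divisor class group (divisorial fractional ideals modulo principal ones) and $T$ its torsion subgroup. For $u\in\mathbb R^s$ let $\mathcal D(u)=K\cdot\{x\in\mathbb Z^d:\sigma(x)\ge u\}$ (componentwise inequality, $x$ being identified with the corresponding monomial), and call a class in $\operatorname{Cl}(R)$ conic if it is the class of $\mathcal C(y)=K\cdot(\mathbb Z^d\cap(y+\mathbb R_+M))$ for some $y\in\mathbb R^d$. The classes in $\operatorname{Cl}(R)$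 are exactly the classes of the ideals $\mathcal D(u)$, $u\in\mathbb Z^s$, and sending the residue class modulo $T$ of $[\mathcal D(u)]$ to $u+\sigma(\mathbb R^d)$, for $u\in\mathbb Z^s$, gives a well-defined injective group homomorphism $\operatorname{Cl}(R)/T\to\mathbb R^s/\sigma(\mathbb R^d)$, by which $\operatorname{Cl}(R)/T$ is regarded as a subgroup of $\mathbb R^s/\sigma(\mathbb R^d)$. There are only finitely many, and at least one, conic classes. Let $P$ be the polytope in $\mathbb R^s/\sigma(\mathbb R^d)$ spanned by (that is, the convex hull of) the images of the conic classes in $\operatorname{Cl}(R)/T$. Then: (a) a class $c\in\operatorname{Cl}(R)$ is conic if and only if its residue class modulo $T$ belongs to $P$; (b) $P$ has dimension $s-d$, and $P$ is centrally symmetric with respect to the point $[\omega]/2$ (the class $[\omega]$ being taken modulo $T$), where $\omega=\bigl(\bigwedge^d\Omega_{R/K}\bigr)^{**}$ is the canonical module of $R$ (${}^*$ denotes the dual $\operatorname{Hom}_R(-,R)$). -/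

import Mathlib

open scoped nonZeroDivisors

noncomputable section

/-! ### Divisorial fractional ideals and the divisor class group of a domain -/

section DivisorClassGroup

variable (A : Type*) [CommRing A] [IsDomain A]

/-- A fractional ideal `I` (in the field of fractions) is divisorial if it is nonzero and
`I = (A : (A : I))`. -/
@[ext]
structure DivisorialIdeal where
  val : FractionalIdeal A⁰ (FractionRing A)
  ne_zero : val ≠ 0
  inv_inv_eq : val⁻¹⁻¹ = val

variable {A}

namespace DivisorialIdeal

theorem mul_ne_zero' {I J : FractionalIdeal A⁰ (FractionRing A)} (hI : I ≠ 0) (hJ : J ≠ 0) :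
    I * J ≠ 0 := by
  rw [Ne, FractionalIdeal.eq_zero_iff] at hI hJ ⊢
  push Not at hI hJ ⊢
  obtain ⟨x, hx, hx0⟩ := hI
  obtain ⟨y, hy, hy0⟩ := hJ
  exact ⟨x * y, FractionalIdeal.mul_mem_mul hx hy, mul_ne_zero hx0 hy0⟩

theorem inv_ne_zero' {I : FractionalIdeal A⁰ (FractionRing A)} (hI : I ≠ 0) : I⁻¹ ≠ 0 := by
  intro h
  have := FractionalIdeal.bot_lt_mul_inv (I := I) hI
  rw [h, mul_zero] at this
  exact lt_irrefl _ this

theorem le_inv_iff {I J : FractionalIdeal A⁰ (FractionRing A)} (hI : I ≠ 0) :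
    J ≤ I⁻¹ ↔ J * I ≤ 1 := by
  rw [FractionalIdeal.inv_eq, FractionalIdeal.le_div_iff_mul_le hI]

theorem le_inv_inv {I : FractionalIdeal A⁰ (FractionRing A)} (hI : I ≠ 0) : I ≤ I⁻¹⁻¹ := by
  rw [le_inv_iff (inv_ne_zero' hI), mul_comm, ← le_inv_iff hI]

theorem inv_inv_inv {I : FractionalIdeal A⁰ (FractionRing A)} (hI : I ≠ 0) :
    I⁻¹⁻¹⁻¹ = I⁻¹ :=
  le_antisymm
    (FractionalIdeal.inv_anti_mono hI (inv_ne_zero' (inv_ne_zero' hI)) (le_inv_inv hI))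
    (le_inv_inv (inv_ne_zero' hI))

theorem inv_closure_mul {I J : FractionalIdeal A⁰ (FractionRing A)} (hI : I ≠ 0) (hJ : J ≠ 0) :
    (I⁻¹⁻¹ * J)⁻¹ = (I * J)⁻¹ := by
  have hI' := inv_ne_zero' (inv_ne_zero' hI)
  refine eq_of_forall_le_iff fun X => ?_
  rw [le_inv_iff (mul_ne_zero' hI' hJ), le_inv_iff (mul_ne_zero' hI hJ), mul_comm _ J,
    ← mul_assoc, ← le_inv_iff hI', inv_inv_inv hI, le_inv_iff hI, mul_comm I J, ← mul_assoc]

/-- The product of divisorial ideals is the divisorial closure of their product as fractional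
ideals. -/
instance : Mul (DivisorialIdeal A) :=
  ⟨fun I J => ⟨(I.val * J.val)⁻¹⁻¹,
    inv_ne_zero' (inv_ne_zero' (mul_ne_zero' I.ne_zero J.ne_zero)),
    inv_inv_inv (inv_ne_zero' (mul_ne_zero' I.ne_zero J.ne_zero))⟩⟩

instance : One (DivisorialIdeal A) :=
  ⟨⟨1, one_ne_zero, by rw [inv_one, inv_one]⟩⟩

theorem val_mul (I J : DivisorialIdeal A) : (I * J).val = (I.val * J.val)⁻¹⁻¹ := rfl

theorem val_one : (1 : DivisorialIdeal A).val = 1 := rfl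

instance : CommMonoid (DivisorialIdeal A) where
  mul_assoc I J L := DivisorialIdeal.ext <| by
    rw [val_mul, val_mul, val_mul, val_mul, inv_closure_mul (mul_ne_zero' I.ne_zero J.ne_zero) L.ne_zero,
      mul_comm I.val ((J.val * L.val)⁻¹⁻¹), inv_closure_mul (mul_ne_zero' J.ne_zero L.ne_zero) I.ne_zero,
      mul_comm _ I.val, mul_assoc]
  one_mul I := DivisorialIdeal.ext <| by rw [val_mul, val_one, one_mul, I.inv_inv_eq]
  mul_one I := DivisorialIdeal.ext <| by rw [val_mul, val_one, mul_one, I.inv_inv_eq]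
  mul_comm I J := DivisorialIdeal.ext <| by rw [val_mul, val_mul, mul_comm]

variable (A) in
/-- The principal fractional ideal generated by a nonzero element of the field of fractions,
as a divisorial ideal. -/
def principal : (FractionRing A)ˣ →* DivisorialIdeal A where
  toFun x := ⟨FractionalIdeal.spanSingleton A⁰ (x : FractionRing A),
    FractionalIdeal.spanSingleton_ne_zero_iff.2 x.ne_zero,
    by rw [FractionalIdeal.spanSingleton_inv, FractionalIdeal.spanSingleton_inv, inv_inv]⟩
  map_one' := DivisorialIdeal.ext <| by
    simp only [val_one, Units.val_one, FractionalIdeal.spanSingleton_one]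
  map_mul' x y := DivisorialIdeal.ext <| by
    rw [val_mul]
    simp only [FractionalIdeal.spanSingleton_mul_spanSingleton,
      FractionalIdeal.spanSingleton_inv, inv_inv, Units.val_mul]

/-- Over a normal Noetherian domain every divisorial ideal is invertible with respect to the
divisorial product. -/
theorem isUnit [IsNoetherianRing A] [IsIntegrallyClosed A] (I : DivisorialIdeal A) :
    IsUnit I := by
  have h0 := inv_ne_zero' I.ne_zero
  have hm := mul_ne_zero' I.ne_zero h0
  have key : (I.val * I.val⁻¹)⁻¹ = 1 := by
    refine le_antisymm (fun x hx => ?_) ?_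
    · have hxI : ∀ y ∈ I.val, x * y ∈ I.val := by
        intro y hy
        rw [← I.inv_inv_eq, FractionalIdeal.mem_inv_iff h0]
        intro z hz
        rw [mul_assoc]
        exact (FractionalIdeal.mem_inv_iff hm).1 hx _ (FractionalIdeal.mul_mem_mul hy hz)
      have hint : IsIntegral A x := by
        have hfg : (I.val : Submodule A (FractionRing A)).FG :=
          isNoetherian_submodule.1 (FractionalIdeal.isNoetherian I.val) _ le_rfl
        refine isIntegral_of_smul_mem_submodule
          (N := (I.val : Submodule A (FractionRing A))) ?_ hfg x fun y hy => hxI y hy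
        intro h
        exact I.ne_zero (FractionalIdeal.coeToSubmodule_eq_bot.1 h)
      obtain ⟨a, ha⟩ := IsIntegrallyClosed.isIntegral_iff.1 hint
      exact (FractionalIdeal.mem_one_iff _).2 ⟨a, ha⟩
    · rw [le_inv_iff hm, one_mul, mul_comm, ← le_inv_iff I.ne_zero]
  refine IsUnit.of_mul_eq_one ⟨I.val⁻¹, h0, inv_inv_inv I.ne_zero⟩ (DivisorialIdeal.ext ?_)
  rw [val_mul, val_one]
  change (I.val * I.val⁻¹)⁻¹⁻¹ = 1
  rw [key, inv_one]

end DivisorialIdeal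

variable (A)

/-- The divisor class group `Cl(A)`, written additively: (invertible) divisorial ideals modulo
principal ones. By `DivisorialIdeal.isUnit`, over a normal Noetherian domain all divisorial
ideals occur. -/
def DivisorClassGroup : Type _ :=
  Additive ((DivisorialIdeal A)ˣ ⧸ (DivisorialIdeal.principal A).toHomUnits.range)

instance : AddCommGroup (DivisorClassGroup A) :=
  inferInstanceAs (AddCommGroup
    (Additive ((DivisorialIdeal A)ˣ ⧸ (DivisorialIdeal.principal A).toHomUnits.range)))

variable {A}

/-- The class of a divisorial ideal. -/
def DivisorClassGroup.mk (I : (DivisorialIdeal A)ˣ) : DivisorClassGroup A :=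
  Additive.ofMul (QuotientGroup.mk I)

/-- `c = [N]`: the module `N` is isomorphic to a divisorial ideal in the class `c`. (Two
divisorial ideals are isomorphic as modules exactly when they have the same class.) -/
def HasDivisorClass (N : Type*) [AddCommGroup N] [Module A N] (c : DivisorClassGroup A) : Prop :=
  ∃ I : (DivisorialIdeal A)ˣ, DivisorClassGroup.mk I = c ∧
    Nonempty (N ≃ₗ[A] ((I : DivisorialIdeal A).val : Submodule A (FractionRing A)))

end DivisorClassGroup

/-! ### Positive normal affine monoids and their algebras -/

section Monoid

variable {d : ℕ}

/-- The vector of `ℝ^d` (or `ℝ^s`) given by an integral vector. -/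
def realVec {n : ℕ} (z : Fin n → ℤ) : Fin n → ℝ := fun i => (z i : ℝ)

/-- `M` is a positive normal affine monoid with `gp(M) = ℤ^d`. -/
structure IsPositiveNormalAffine (M : AddSubmonoid (Fin d → ℤ)) : Prop where
  fg : M.FG
  gp : AddSubgroup.closure (M : Set (Fin d → ℤ)) = ⊤
  normal : ∀ (x : Fin d → ℤ) (n : ℕ), 0 < n → n • x ∈ M → x ∈ M
  positive : ∀ x ∈ M, -x ∈ M → x = 0

/-- The cone `ℝ₊M` generated by `M` in `ℝ^d`. -/
def realCone (M : AddSubmonoid (Fin d → ℤ)) : PointedCone ℝ (Fin d → ℝ) :=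
  PointedCone.hull ℝ (realVec '' (M : Set (Fin d → ℤ)))

/-- The linear map `σ = (σ_1, …, σ_s) : ℝ^d → ℝ^s` given by `s` integral linear forms, the rows of
an integral matrix. -/
def realMap {s : ℕ} (σ : Matrix (Fin s) (Fin d) ℤ) : (Fin d → ℝ) →ₗ[ℝ] (Fin s → ℝ) :=
  (σ.map (Int.cast : ℤ → ℝ)).mulVecLin

/-- `ℝ₊M = {x : σ_i(x) ≥ 0, i = 1, …, s}` is an irredundant representation of the cone by
primitive integral forms. -/
structure IsIrredundantRepresentation {s : ℕ} (M : AddSubmonoid (Fin d → ℤ))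
    (σ : Matrix (Fin s) (Fin d) ℤ) : Prop where
  primitive : ∀ i, Finset.univ.gcd (σ i) = 1
  mem_iff : ∀ x, x ∈ realCone M ↔ ∀ i, 0 ≤ realMap σ x i
  irredundant : ∀ i, ∃ x, x ∉ realCone M ∧ ∀ j, j ≠ i → 0 ≤ realMap σ x j

variable (K : Type*) [Field K] (M : AddSubmonoid (Fin d → ℤ))

/-- The monoid algebra `R = K[M]`. -/
abbrev MonoidRing : Type _ := AddMonoidAlgebra K M

/-- The group algebra `K[ℤ^d]`. -/
abbrev LaurentRing (K : Type*) [Field K] (d : ℕ) : Type _ := AddMonoidAlgebra K (Fin d → ℤ)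

instance : UniqueSums M :=
  UniqueSums.of_injective_addHom (M.subtype : M →+ (Fin d → ℤ)).toAddHom
    Subtype.coe_injective inferInstance

instance : IsDomain (MonoidRing K M) := inferInstance

/-- `K[ℤ^d]` as an algebra over its subring `K[M]`. -/
instance monoidRingAlgebra : Algebra (MonoidRing K M) (LaurentRing K d) :=
  (AddMonoidAlgebra.mapDomainRingHom K M.subtype).toAlgebra

/-- The `K[M]`-submodule of `K[ℤ^d]` generated by the monomials with exponents in `S`. It is
`K · S` whenever `S + M ⊆ S`; see `mem_monomialIdeal`. -/
def monomialIdeal (S : Set (Fin d → ℤ)) : Submodule (MonoidRing K M) (LaurentRing K d) :=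
  Submodule.span (MonoidRing K M) ((fun z => AddMonoidAlgebra.single z (1 : K)) '' S)

theorem mem_monomialIdeal {S : Set (Fin d → ℤ)} (hS : ∀ z ∈ S, ∀ m ∈ M, z + m ∈ S)
    (f : LaurentRing K d) :
    f ∈ monomialIdeal K M S ↔ ∀ z, f.coeff z ≠ 0 → z ∈ S := by
  have hsm : ∀ (m : M) (r : K) (g : LaurentRing K d),
      (AddMonoidAlgebra.single m r : MonoidRing K M) • g =
        AddMonoidAlgebra.single (m : Fin d → ℤ) r * g := fun m r g => by
    rw [Algebra.smul_def]
    change AddMonoidAlgebra.mapDomainRingHom K M.subtype _ * g = _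
    rw [AddMonoidAlgebra.mapDomainRingHom_apply, AddMonoidAlgebra.mapDomain_single]
    rfl
  constructor
  · intro hf
    refine Submodule.span_induction (p := fun f _ => ∀ z, f.coeff z ≠ 0 → z ∈ S)
      ?_ ?_ ?_ ?_ hf
    · rintro _ ⟨z, hz, rfl⟩ w hw
      simp only [AddMonoidAlgebra.coeff_single, Finsupp.single_apply] at hw
      by_cases h : z = w
      · exact h ▸ hz
      · simp [h] at hw
    · intro z hz
      simp at hz
    · intro f g _ _ hf hg z hz
      by_cases h : f.coeff z = 0
      · refine hg z fun h' => hz ?_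
        simp [h, h']
      · exact hf z h
    · intro a f _ hf
      induction a using AddMonoidAlgebra.induction_linear with
      | zero => intro z hz; simp at hz
      | add a b ha hb =>
        intro z hz
        by_cases h : (a • f).coeff z = 0
        · refine hb z fun h' => hz ?_
          simp [add_smul, h, h']
        · exact ha z h
      | single m r =>
        intro z hz
        rw [hsm, AddMonoidAlgebra.coeff_single_mul_apply] at hz
        have := hS _ (hf _ (right_ne_zero_of_mul hz)) m m.2
        simpa using this
  · intro hf
    rw [← AddMonoidAlgebra.sum_coeff_single f]
    refine Submodule.sum_mem _ fun z hz => ?_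
    have h1 : (AddMonoidAlgebra.single z (f.coeff z) : LaurentRing K d) =
        (AddMonoidAlgebra.single (0 : M) (f.coeff z) : MonoidRing K M) •
          (AddMonoidAlgebra.single z (1 : K) : LaurentRing K d) := by
      rw [hsm, AddMonoidAlgebra.single_mul_single]
      simp
    rw [h1]
    exact Submodule.smul_mem _ _
      (Submodule.subset_span ⟨z, hf z (Finsupp.mem_support_iff.1 hz), rfl⟩)

/-- `𝒟(u) = K · {x ∈ ℤ^d : σ(x) ≥ u}` for `u ∈ ℝ^s`. -/
def divisorialMonomialIdeal {s : ℕ} (σ : Matrix (Fin s) (Fin d) ℤ) (u : Fin s → ℝ) :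
    Submodule (MonoidRing K M) (LaurentRing K d) :=
  monomialIdeal K M {x | u ≤ realMap σ (realVec x)}

/-- The conic ideal `𝒞(y) = K · (ℤ^d ∩ (y + ℝ₊M))` for `y ∈ ℝ^d`. -/
def conicIdeal (y : Fin d → ℝ) : Submodule (MonoidRing K M) (LaurentRing K d) :=
  monomialIdeal K M {x | realVec x - y ∈ realCone M}

theorem realVec_add {n : ℕ} (x y : Fin n → ℤ) : realVec (x + y) = realVec x + realVec y := by
  funext i
  simp [realVec]

theorem mem_divisorialMonomialIdeal {s : ℕ} {σ : Matrix (Fin s) (Fin d) ℤ}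
    (hσ : IsIrredundantRepresentation M σ) (u : Fin s → ℝ) (f : LaurentRing K d) :
    f ∈ divisorialMonomialIdeal K M σ u ↔
      ∀ z, f.coeff z ≠ 0 → u ≤ realMap σ (realVec z) := by
  refine mem_monomialIdeal K M (S := {x | u ≤ realMap σ (realVec x)}) ?_ f
  intro z hz m hm i
  have h := (hσ.mem_iff (realVec m)).1 (Submodule.subset_span ⟨m, hm, rfl⟩) i
  have hzi : u i ≤ realMap σ (realVec z) i := hz i
  rw [realVec_add, map_add, Pi.add_apply]
  linarith

theorem mem_conicIdeal (y : Fin d → ℝ) (f : LaurentRing K d) :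
    f ∈ conicIdeal K M y ↔ ∀ z, f.coeff z ≠ 0 → realVec z - y ∈ realCone M := by
  refine mem_monomialIdeal K M (fun z hz m hm => ?_) f
  have h : realVec m ∈ realCone M := Submodule.subset_span ⟨m, hm, rfl⟩
  change realVec (z + m) - y ∈ realCone M
  rw [realVec_add, add_sub_right_comm]
  exact add_mem hz h

/-- A divisor class is conic if it is the class of a conic ideal. -/
def IsConicClass (c : DivisorClassGroup (MonoidRing K M)) : Prop :=
  ∃ y : Fin d → ℝ, HasDivisorClass (conicIdeal K M y) c

/-- The polytope spanned by the images of the conic classes in `ℝ^s / σ(ℝ^d)`, where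
`Cl(R)/T` is embedded by `ι` (and `T` is the torsion subgroup). -/
def conicPolytope {s : ℕ} (σ : Matrix (Fin s) (Fin d) ℤ)
    (ι : DivisorClassGroup (MonoidRing K M) ⧸
        AddCommGroup.torsion (DivisorClassGroup (MonoidRing K M)) →+
      (Fin s → ℝ) ⧸ LinearMap.range (realMap σ)) :
    Set ((Fin s → ℝ) ⧸ LinearMap.range (realMap σ)) :=
  convexHull ℝ {v | ∃ c, IsConicClass K M c ∧ ι (QuotientAddGroup.mk c) = v}

/-- The canonical module `ω` of the `d`-dimensional normal domain `R = K[M]`: the reflexive hull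
(bidual) of the module of top differential forms `⋀^d Ω_{R/K}`. -/
abbrev CanonicalModule : Type _ :=
  Module.Dual (MonoidRing K M) (Module.Dual (MonoidRing K M)
    (⋀[MonoidRing K M]^d (Ω[MonoidRing K M⁄K])))

end Monoid

end

/-!
Fix the integral forms `σ`. By normality `M = {x ∈ ℤ^d : σ(x) ≥ 0}`, and the whole statement is
about the `ℤ^d`-graded ideals `𝒟(u)`, `u ∈ ℤ^s`, inside the Laurent polynomial ring `L = K[ℤ^d]`.

*Polyhedral input.* Real solutions of rational systems are replaced by rational ones with the same
signs (`exists_rat_functional`). This gives `M = {σ ≥ 0}` (`mem_monoid_iff`), the injectivity of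
`σ`, and lattice points in the interior of the cone and in the relative interior of each facet.
The facet points show that every `σ_i` attains the value `u_i` on `{x ∈ ℤ^d : σ(x) ≥ u}`
(`exists_attain`), so that `u` can be recovered from `𝒟(u)`.

*Class group.* Testing on monomials gives `𝒟(u)⁻¹ = 𝒟(-u)` and `(𝒟(u) 𝒟(v))⁻¹⁻¹ = 𝒟(u + v)`, hence
a homomorphism `ℤ^s → Cl(R)`, `u ↦ [𝒟(u)]` (`latticeClass`). If `𝒟(u) = f R` then `f` is a unit of
`L` with `f ∈ 𝒟(u)` and `f⁻¹ ∈ 𝒟(-u)`, and opposite exponents of `f` and `f⁻¹` give `u ∈ σ(ℤ^d)`;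
so the kernel is `σ(ℤ^d)`. For surjectivity, a divisorial ideal `I` is scaled, using that `L` is
factorial, so that it lies in `L` and has greatest common divisor `1` there; then `I⁻¹ ⊆ L`, and
comparing lowest terms with respect to each `σ_i` shows `I⁻¹ ⊆ 𝒟(-u)`, where `u_i` is the least
value of `σ_i` on the exponents in `I`; therefore `I = 𝒟(u)` (`exists_eq_latticeFractionalIdeal`).
An integral vector in `σ(ℝ^d)` has a multiple in `σ(ℤ^d)`, so modulo torsion `Cl(R)` embeds into
`ℝ^s / σ(ℝ^d)` (`exists_classEmbedding`).

*Canonical module.* The determinant with respect to logarithmic differentials is a map `φ : ⋀^d Ω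
→ L`, and every `R`-linear map `⋀^d Ω → L` is a multiple of `φ`, because after inverting monomials
`Ω` is generated by `d log x_1, …, d log x_d`. The values of `φ` lie in `𝒟(1, …, 1)`, since `d`
elements of a facet are linearly dependent, and along each facet some value vanishes to first
order only. Hence `(⋀^d Ω)^* ≅ 𝒟(-1, …, -1)`, and `(⋀^d Ω)^{**} ≅ 𝒟(1, …, 1)`
(`nonempty_canonicalModule_equiv`).

*Conic classes.* Here `𝒞(y) = 𝒟(⌈σ(y)⌉)`. As `⌈σ(y)⌉ - σ(y) ∈ [0, 1)^s`, the polytope `P` is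
contained in the image of the cube `[0, 1)^s`; conversely, if an integral `u` lies in that image,
then `u - σ(y) ∈ [0, 1)^s` for some `y`, that is, `u = ⌈σ(y)⌉`. Thus a class is conic if and only
if its image lies in `P`. Moving `-y` slightly into the cone turns ceilings into `⌊·⌋ + 1`, so
`(1, …, 1) - ⌈σ(y)⌉` is again of the form `⌈σ(y')⌉`, which is the central symmetry. Points near
the origin in the interior of the cone and in the relative interior of the `i`-th facet give `(1,
…, 1)` and `(1, …, 1) - e_i`, so `P` has full dimension.
-/

noncomputable section

/-! ### Rational points of rational cones -/

/-- Finitely many real numbers can be mapped to rational numbers of the same signs by a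
`ℚ`-linear functional: perturb a `ℚ`-basis of their span to rational numbers. This transfers
real solutions of rational systems of equalities and inequalities to rational solutions. -/
theorem exists_rat_functional {T : Set ℝ} (hT : T.Finite) :
    ∃ ρ : ℝ →ₗ[ℚ] ℚ, ∀ a ∈ T, (0 < a → 0 < ρ a) ∧ (a < 0 → ρ a < 0) := by
  classical
  let W := Submodule.span ℚ T
  have : FiniteDimensional ℚ W := FiniteDimensional.span_of_finite ℚ hT
  let b := Module.finBasis ℚ W
  let f : W → (Fin (Module.finrank ℚ W) → ℝ) → ℝ := fun w x => ∑ k, (b.repr w k : ℝ) * x k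
  have hfb : ∀ w : W, f w (fun k => (b k : ℝ)) = w := by
    intro w
    have := congrArg (Subtype.val) (b.sum_repr w)
    rw [← this]
    simp only [f, AddSubmonoidClass.coe_finsetSum, SetLike.val_smul, Rat.smul_def]
  have hcont : ∀ w, Continuous (f w) := fun w => by fun_prop
  have hopen : IsOpen {x | ∀ a ∈ T, ∀ h : a ∈ W,
      (0 < a → 0 < f ⟨a, h⟩ x) ∧ (a < 0 → f ⟨a, h⟩ x < 0)} := by
    have : {x | ∀ a ∈ T, ∀ h : a ∈ W, (0 < a → 0 < f ⟨a, h⟩ x) ∧ (a < 0 → f ⟨a, h⟩ x < 0)} =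
        ⋂ a ∈ T, {x | ∀ h : a ∈ W, (0 < a → 0 < f ⟨a, h⟩ x) ∧ (a < 0 → f ⟨a, h⟩ x < 0)} := by
      ext x; simp
    rw [this]
    refine hT.isOpen_biInter fun a ha => ?_
    have haW : a ∈ W := Submodule.subset_span ha
    simp only [haW, forall_true_left]
    rcases lt_trichotomy a 0 with h | h | h
    · simp only [h.not_gt, h, false_imp_iff, true_and, forall_true_left]
      exact isOpen_lt (hcont _) continuous_const
    · simp [h]
    · simp only [h.not_gt, h, false_imp_iff, and_true, forall_true_left]
      exact isOpen_lt continuous_const (hcont _)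
  have hdense : DenseRange (Pi.map fun (_ : Fin (Module.finrank ℚ W)) => (Rat.cast : ℚ → ℝ)) :=
    DenseRange.piMap fun _ => Rat.denseRange_cast
  obtain ⟨q, hq⟩ := hdense.exists_mem_open hopen
    ⟨fun k => (b k : ℝ), fun a _ h => by rw [hfb]; exact ⟨id, id⟩⟩
  obtain ⟨ρ, hρ⟩ := LinearMap.exists_extend (b.constr ℚ q)
  refine ⟨ρ, fun a ha => ?_⟩
  have haW : a ∈ W := Submodule.subset_span ha
  have hval : ((ρ a : ℚ) : ℝ) = f ⟨a, haW⟩ (Pi.map (fun _ => (Rat.cast : ℚ → ℝ)) q) := by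
    have : ρ a = b.constr ℚ q ⟨a, haW⟩ := by rw [← hρ]; rfl
    rw [this, Module.Basis.constr_apply_fintype]
    simp [f]
  have := hq a ha haW
  rw [← hval] at this
  exact_mod_cast this

theorem exists_common_denominator {ι : Type*} [Finite ι] (q : ι → ℚ) :
    ∃ (n : ℕ) (z : ι → ℤ), 0 < n ∧ ∀ i, (z i : ℚ) = n * q i := by
  classical
  cases nonempty_fintype ι
  refine ⟨∏ i, (q i).den, fun i => (∏ j ∈ Finset.univ.erase i, ((q j).den : ℤ)) * (q i).num,
    Finset.prod_pos fun i _ => (q i).den_pos, fun i => ?_⟩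
  rw [← Finset.mul_prod_erase _ _ (Finset.mem_univ i)]
  push_cast
  rw [mul_comm ((q i).den : ℚ), mul_assoc, mul_comm ((q i).den : ℚ), Rat.mul_den_eq_num]

section Geometry

variable {d s : ℕ} {M : AddSubmonoid (Fin d → ℤ)} {σ : Matrix (Fin s) (Fin d) ℤ}

theorem realMap_realVec (z : Fin d → ℤ) : realMap σ (realVec z) = realVec (σ.mulVec z) := by
  funext i
  simp [realMap, realVec, Matrix.mulVec, dotProduct]

theorem realVec_le {n : ℕ} {x y : Fin n → ℤ} : realVec x ≤ realVec y ↔ x ≤ y := by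
  simp [realVec, Pi.le_def]

theorem realMap_apply (y : Fin d → ℝ) (i : Fin s) : realMap σ y i = ∑ k, (σ i k : ℝ) * y k := by
  simp [realMap, Matrix.mulVec, dotProduct]

theorem mulVec_apply (z : Fin d → ℤ) (i : Fin s) : σ.mulVec z i = ∑ k, σ i k * z k := rfl

/-- A real vector can be replaced by an integral one without changing the signs of its
coordinates and of the values of the integral linear forms on it. -/
theorem exists_int_same_sign (σ : Matrix (Fin s) (Fin d) ℤ) (y : Fin d → ℝ) :
    ∃ z : Fin d → ℤ, (∀ k, y k ≠ 0 → z k ≠ 0) ∧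
      ∀ i, (0 < realMap σ y i → 0 < σ.mulVec z i) ∧ (realMap σ y i < 0 → σ.mulVec z i < 0) ∧
        (realMap σ y i = 0 → σ.mulVec z i = 0) := by
  obtain ⟨ρ, hρ⟩ := exists_rat_functional
    (T := Set.range y ∪ Set.range (realMap σ y)) ((Set.finite_range _).union (Set.finite_range _))
  obtain ⟨n, z, hn, hz⟩ := exists_common_denominator (fun k => ρ (y k))
  have hn' : (0 : ℚ) < n := by exact_mod_cast hn
  have key : ∀ i, ((σ.mulVec z i : ℤ) : ℚ) = n * ρ (realMap σ y i) := by
    intro i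
    rw [realMap_apply, mulVec_apply, map_sum, Finset.mul_sum]
    push_cast
    refine Finset.sum_congr rfl fun k _ => ?_
    have : ρ ((σ i k : ℝ) * y k) = (σ i k : ℚ) * ρ (y k) := by
      have := ρ.map_smul (σ i k : ℚ) (y k)
      rw [Rat.smul_def, smul_eq_mul] at this
      rw [← this]; push_cast; rfl
    rw [this, hz]; ring
  refine ⟨z, fun k hk h0 => ?_, fun i => ⟨fun h => ?_, fun h => ?_, fun h => ?_⟩⟩
  · have h1 := hz k
    rw [h0] at h1
    have h2 : ρ (y k) = 0 := by
      rcases mul_eq_zero.1 h1.symm with h | h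
      · exact absurd h hn'.ne'
      · exact h
    have h3 := hρ (y k) (Or.inl ⟨k, rfl⟩)
    rcases lt_or_gt_of_ne hk with h | h
    · exact absurd (h3.2 h) (by rw [h2]; exact lt_irrefl _)
    · exact absurd (h3.1 h) (by rw [h2]; exact lt_irrefl _)
  · have := (hρ _ (Or.inr ⟨i, rfl⟩)).1 h
    have h2 := mul_pos hn' this
    rw [← key] at h2
    exact_mod_cast h2
  · have := (hρ _ (Or.inr ⟨i, rfl⟩)).2 h
    have h2 := mul_neg_of_pos_of_neg hn' this
    rw [← key] at h2
    exact_mod_cast h2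
  · have := key i
    rw [h, map_zero, mul_zero] at this
    exact_mod_cast this

/-- An integral vector in the real image of an integral matrix has a positive multiple in the
integral image. -/
theorem exists_nsmul_eq_mulVec {u : Fin s → ℤ} {y : Fin d → ℝ} (h : realVec u = realMap σ y) :
    ∃ (n : ℕ) (z : Fin d → ℤ), 0 < n ∧ n • u = σ.mulVec z := by
  obtain ⟨ρ, hρ⟩ := exists_rat_functional (T := {1}) (Set.finite_singleton _)
  have h1 := (hρ 1 rfl).1 one_pos
  obtain ⟨n, z, hn, hz⟩ := exists_common_denominator (fun k : Option (Fin d) => ρ (k.elim 1 y))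
  have hn' : (0 : ℚ) < n := by exact_mod_cast hn
  have hz0 : 0 < z none := by
    have : (0 : ℚ) < z none := by rw [hz]; exact mul_pos hn' h1
    exact_mod_cast this
  refine ⟨(z none).toNat, fun k => z (some k), by omega, ?_⟩
  funext i
  have h2 := congrArg ρ (congrFun h i)
  rw [realMap_apply, map_sum] at h2
  have hs : ∀ (a : ℤ) (r : ℝ), ρ ((a : ℝ) * r) = a * ρ r := fun a r => by
    have := ρ.map_smul (a : ℚ) r
    rw [Rat.smul_def, smul_eq_mul] at this
    rw [← this]; push_cast; rfl
  have h3 : ρ (realVec u i) = u i * ρ 1 := by rw [← hs, mul_one]; rfl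
  rw [h3] at h2
  have : ((z none * u i : ℤ) : ℚ) = ((σ.mulVec (fun k => z (some k)) i : ℤ) : ℚ) := by
    rw [mulVec_apply]
    push_cast
    simp only [hz, Option.elim]
    rw [mul_assoc, mul_comm (ρ 1), h2, Finset.mul_sum]
    refine Finset.sum_congr rfl fun k _ => ?_
    rw [hs]; ring
  have h4 : z none * u i = σ.mulVec (fun k => z (some k)) i := by exact_mod_cast this
  rw [← h4, Pi.smul_apply, nsmul_eq_mul, Int.toNat_of_nonneg hz0.le]

theorem realVec_mem_realCone {z : Fin d → ℤ} (hz : z ∈ M) : realVec z ∈ realCone M :=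
  Submodule.subset_span ⟨z, hz, rfl⟩

/-- By normality, the lattice points of the cone are the elements of the monoid. -/
theorem IsPositiveNormalAffine.mem_of_mem_realCone (hM : IsPositiveNormalAffine M)
    {z : Fin d → ℤ} (hz : realVec z ∈ realCone M) : z ∈ M := by
  obtain ⟨k, c, g, hg⟩ := Submodule.mem_span_set'.1 hz
  have hg' : ∀ i, ∃ m ∈ M, realVec m = (g i : Fin d → ℝ) := fun i => (g i).2
  choose m hmM hm using hg'
  obtain ⟨ρ, hρ⟩ := exists_rat_functional
    (T := insert 1 (Set.range fun i => (c i : ℝ))) ((Set.finite_range _).insert _)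
  have h1 := (hρ 1 (Or.inl rfl)).1 one_pos
  have hc : ∀ i, 0 ≤ ρ (c i : ℝ) := fun i => by
    rcases (c i).2.eq_or_lt with h | h
    · rw [← h, map_zero]
    · exact ((hρ _ (Or.inr ⟨i, rfl⟩)).1 h).le
  obtain ⟨n, a, hn, ha⟩ := exists_common_denominator
    (fun i : Option (Fin k) => ρ (i.elim (1 : ℝ) fun i => (c i : ℝ)))
  have hn' : (0 : ℚ) < n := by exact_mod_cast hn
  have ha0 : 0 < a none := by
    have : (0 : ℚ) < a none := by rw [ha]; exact mul_pos hn' h1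
    exact_mod_cast this
  have hai : ∀ i, 0 ≤ a (some i) := fun i => by
    have : (0 : ℚ) ≤ a (some i) := by rw [ha]; exact mul_nonneg hn'.le (hc i)
    exact_mod_cast this
  have hs : ∀ (b : ℤ) (r : ℝ), ρ (r * (b : ℝ)) = b * ρ r := fun b r => by
    have := ρ.map_smul (b : ℚ) r
    rw [Rat.smul_def, smul_eq_mul] at this
    rw [← this, mul_comm]; push_cast; rfl
  refine hM.normal z (a none).toNat (by omega) ?_
  have : (a none).toNat • z = ∑ i, (a (some i)).toNat • m i := by
    funext j
    have h2 : ρ (∑ i, (c i : ℝ) * (m i j : ℝ)) = ρ (1 * (z j : ℝ)) := by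
      congr 1
      have := congrFun hg j
      simp only [Finset.sum_apply, ← hm] at this
      rw [one_mul]
      exact this
    rw [hs, map_sum] at h2
    simp only [hs] at h2
    have h3 : ((a none * z j : ℤ) : ℚ) = ((∑ i, a (some i) * m i j : ℤ) : ℚ) := by
      push_cast
      simp only [ha, Option.elim]
      rw [mul_assoc, mul_comm (ρ 1), ← h2, Finset.mul_sum]
      exact Finset.sum_congr rfl fun i _ => by ring
    have h4 : a none * z j = ∑ i, a (some i) * m i j := by exact_mod_cast h3
    rw [Finset.sum_apply, Pi.smul_apply, nsmul_eq_mul, Int.toNat_of_nonneg ha0.le, h4]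
    exact Finset.sum_congr rfl fun i _ => by
      rw [Pi.smul_apply, nsmul_eq_mul, Int.toNat_of_nonneg (hai i)]
  rw [this]
  exact AddSubmonoid.sum_mem _ fun i _ => AddSubmonoid.nsmul_mem _ (hmM i) _

/-! ### Lattice points of the cone -/

variable (hM : IsPositiveNormalAffine M) (hσ : IsIrredundantRepresentation M σ)
include hM hσ

theorem mem_monoid_iff {z : Fin d → ℤ} : z ∈ M ↔ 0 ≤ σ.mulVec z := by
  have : z ∈ M ↔ realVec z ∈ realCone M :=
    ⟨realVec_mem_realCone, hM.mem_of_mem_realCone⟩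
  rw [this, hσ.mem_iff, realMap_realVec]
  simp [realVec, Pi.le_def]

theorem realMap_injective : Function.Injective (realMap σ) := by
  rw [injective_iff_map_eq_zero]
  intro y hy
  obtain ⟨z, hz1, hz2⟩ := exists_int_same_sign σ y
  have hz0 : σ.mulVec z = 0 := funext fun i => (hz2 i).2.2 (congrFun hy i)
  have : z = 0 := hM.positive z ((mem_monoid_iff hM hσ).2 hz0.ge)
    ((mem_monoid_iff hM hσ).2 (by rw [Matrix.mulVec_neg, hz0, neg_zero]))
  funext k
  by_contra hk
  exact hz1 k hk (congrFun this k)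

/-- The cone has an interior lattice point. -/
theorem exists_interior : ∃ m : Fin d → ℤ, ∀ i, 0 < σ.mulVec m i := by
  have h : ∀ i, ∃ m ∈ M, 0 < σ.mulVec m i := by
    intro i
    by_contra hcon
    push Not at hcon
    have hM0 : ∀ m ∈ M, σ.mulVec m i = 0 := fun m hm =>
      le_antisymm (hcon m hm) ((mem_monoid_iff hM hσ).1 hm i)
    have hall : ∀ z : Fin d → ℤ, σ.mulVec z i = 0 := by
      intro z
      have hz : z ∈ AddSubgroup.closure (M : Set (Fin d → ℤ)) := by rw [hM.gp]; trivial
      refine AddSubgroup.closure_induction (p := fun z _ => σ.mulVec z i = 0) hM0 ?_ ?_ ?_ hz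
      · simp
      · intro x y _ _ hx hy
        rw [Matrix.mulVec_add, Pi.add_apply, hx, hy, add_zero]
      · intro x _ hx
        rw [Matrix.mulVec_neg, Pi.neg_apply, hx, neg_zero]
    have hzero : ∀ k, σ i k = 0 := fun k => by
      have := hall (Pi.single k 1)
      simpa using this
    have hp := hσ.primitive i
    rw [Finset.gcd_eq_zero_iff.2 fun k _ => hzero k] at hp
    exact zero_ne_one hp
  choose m hmM hm using h
  refine ⟨∑ i, m i, fun i => ?_⟩
  rw [Matrix.mulVec_sum, Finset.sum_apply]
  exact Finset.sum_pos' (fun j _ => (mem_monoid_iff hM hσ).1 (hmM j) i)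
    ⟨i, Finset.mem_univ _, hm i⟩

/-- Every facet of the cone has a lattice point in its relative interior. -/
theorem exists_facet_interior (i : Fin s) :
    ∃ m : Fin d → ℤ, σ.mulVec m i = 0 ∧ ∀ j, j ≠ i → 0 < σ.mulVec m j := by
  obtain ⟨m₀, hm₀⟩ := exists_interior hM hσ
  obtain ⟨x, hx, hxj⟩ := hσ.irredundant i
  have hxi : realMap σ x i < 0 := by
    by_contra hcon
    refine hx ((hσ.mem_iff x).2 fun j => ?_)
    by_cases hj : j = i
    · subst hj; exact not_lt.1 hcon
    · exact hxj j hj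
  obtain ⟨z, -, hz⟩ := exists_int_same_sign σ x
  have hzi := (hz i).2.1 hxi
  have hzj : ∀ j, j ≠ i → 0 ≤ σ.mulVec z j := fun j hj => by
    rcases (hxj j hj).eq_or_lt with h | h
    · exact ((hz j).2.2 h.symm).ge
    · exact ((hz j).1 h).le
  -- The segment from the interior point to `z` meets the hyperplane `σ_i = 0` in the facet.
  refine ⟨σ.mulVec m₀ i • z - σ.mulVec z i • m₀, ?_, fun j hj => ?_⟩
  · simp only [Matrix.mulVec_sub, Matrix.mulVec_smul, Pi.sub_apply, Pi.smul_apply, smul_eq_mul]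
    ring
  · simp only [Matrix.mulVec_sub, Matrix.mulVec_smul, Pi.sub_apply, Pi.smul_apply, smul_eq_mul]
    nlinarith [mul_nonneg (hm₀ i).le (hzj j hj), mul_pos (neg_pos.2 hzi) (hm₀ j)]

omit hM in
theorem exists_mulVec_eq_one (i : Fin s) : ∃ v : Fin d → ℤ, σ.mulVec v i = 1 := by
  obtain ⟨v, hv⟩ := Finset.gcd_eq_sum_mul Finset.univ (σ i)
  refine ⟨v, ?_⟩
  rw [mulVec_apply, ← hσ.primitive i, hv]

/-- On `{x ∈ ℤ^d : σ(x) ≥ u}` with `u` integral, each form `σ_i` takes the value `u_i`. -/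
theorem exists_attain (u : Fin s → ℤ) (i : Fin s) :
    ∃ z : Fin d → ℤ, u ≤ σ.mulVec z ∧ σ.mulVec z i = u i := by
  obtain ⟨v, hv⟩ := exists_mulVec_eq_one hσ i
  obtain ⟨m, hmi, hmj⟩ := exists_facet_interior hM hσ i
  -- Adding a large multiple of a facet point to `u_i v` does not change the value of `σ_i`.
  let c : ℤ := ∑ j, |u j - u i * σ.mulVec v j|
  have hval : ∀ j, σ.mulVec (u i • v + c • m) j = u i * σ.mulVec v j + c * σ.mulVec m j :=
    fun j => by
      rw [Matrix.mulVec_add, Matrix.mulVec_smul, Matrix.mulVec_smul]; rfl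
  have heq : σ.mulVec (u i • v + c • m) i = u i := by rw [hval, hv, hmi]; ring
  refine ⟨u i • v + c • m, fun j => ?_, heq⟩
  by_cases hj : j = i
  · rw [hj, heq]
  · rw [hval]
    have hc : |u j - u i * σ.mulVec v j| ≤ c :=
      Finset.single_le_sum (f := fun j => |u j - u i * σ.mulVec v j|)
        (fun _ _ => abs_nonneg _) (Finset.mem_univ j)
    nlinarith [le_abs_self (u j - u i * σ.mulVec v j), hmj j hj,
      abs_nonneg (u j - u i * σ.mulVec v j)]

theorem exists_le_mulVec (u : Fin s → ℤ) : ∃ z : Fin d → ℤ, u ≤ σ.mulVec z := by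
  obtain ⟨m, hm⟩ := exists_interior hM hσ
  refine ⟨(∑ j, |u j|) • m, fun j => ?_⟩
  rw [Matrix.mulVec_smul, Pi.smul_apply, smul_eq_mul]
  have hc : |u j| ≤ ∑ j, |u j| :=
    Finset.single_le_sum (f := fun j => |u j|) (fun _ _ => abs_nonneg _) (Finset.mem_univ j)
  nlinarith [le_abs_self (u j), hm j, abs_nonneg (u j)]

/-- Given finitely many lattice points, some element of the monoid translates all of them into the
monoid. -/
theorem exists_translate_mem {ι : Type*} [Finite ι] (v : ι → Fin d → ℤ) :
    ∃ a ∈ M, ∀ k, a + v k ∈ M := by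
  cases nonempty_fintype ι
  obtain ⟨a, ha⟩ := exists_le_mulVec hM hσ (fun i => ∑ k, |σ.mulVec (v k) i|)
  have h0 : ∀ i, 0 ≤ ∑ k, |σ.mulVec (v k) i| := fun i => Finset.sum_nonneg fun _ _ => abs_nonneg _
  refine ⟨a, (mem_monoid_iff hM hσ).2 fun i => (h0 i).trans (ha i), fun k =>
    (mem_monoid_iff hM hσ).2 fun i => ?_⟩
  have h1 : |σ.mulVec (v k) i| ≤ ∑ k, |σ.mulVec (v k) i| :=
    Finset.single_le_sum (f := fun k => |σ.mulVec (v k) i|) (fun _ _ => abs_nonneg _)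
      (Finset.mem_univ k)
  have h2 := neg_abs_le (σ.mulVec (v k) i)
  have h3 := ha i
  rw [Matrix.mulVec_add, Pi.add_apply, Pi.zero_apply]
  linarith

/-- As `exists_translate_mem`, with a translation parallel to a facet. -/
theorem exists_translate_mem_of_nonneg {ι : Type*} [Finite ι] (v : ι → Fin d → ℤ) (i : Fin s)
    (hv : ∀ k, 0 ≤ σ.mulVec (v k) i) :
    ∃ a ∈ M, σ.mulVec a i = 0 ∧ ∀ k, a + v k ∈ M := by
  cases nonempty_fintype ι
  obtain ⟨m, hmi, hmj⟩ := exists_facet_interior hM hσ i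
  let c : ℤ := ∑ j, ∑ k, |σ.mulVec (v k) j|
  have hc0 : 0 ≤ c := Finset.sum_nonneg fun _ _ => Finset.sum_nonneg fun _ _ => abs_nonneg _
  have hc : ∀ j k, |σ.mulVec (v k) j| ≤ c := fun j k =>
    (Finset.single_le_sum (f := fun k => |σ.mulVec (v k) j|) (fun _ _ => abs_nonneg _)
      (Finset.mem_univ k)).trans
    (Finset.single_le_sum (f := fun j => ∑ k, |σ.mulVec (v k) j|)
      (fun _ _ => Finset.sum_nonneg fun _ _ => abs_nonneg _) (Finset.mem_univ j))
  have hval : ∀ j, σ.mulVec (c • m) j = c * σ.mulVec m j := fun j => by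
    rw [Matrix.mulVec_smul]; rfl
  refine ⟨c • m, (mem_monoid_iff hM hσ).2 fun j => ?_, by rw [hval, hmi, mul_zero], fun k =>
    (mem_monoid_iff hM hσ).2 fun j => ?_⟩
  · rw [hval, Pi.zero_apply]
    by_cases hj : j = i
    · rw [hj, hmi, mul_zero]
    · exact mul_nonneg hc0 (hmj j hj).le
  · rw [Matrix.mulVec_add, Pi.add_apply, hval, Pi.zero_apply]
    by_cases hj : j = i
    · rw [hj, hmi, mul_zero, zero_add]
      exact hv k
    · nlinarith [hmj j hj, hc j k, neg_abs_le (σ.mulVec (v k) j), hc0]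

omit hM in
/-- A primitive form takes the values `1, 0, …, 0` on some basis of `ℤ^d`. -/
theorem exists_basis_sum_eq_one (i : Fin s) :
    ∃ b : Module.Basis (Fin d) ℤ (Fin d → ℤ),
      (∀ k, 0 ≤ σ.mulVec (b k) i) ∧ ∑ k, σ.mulVec (b k) i = 1 := by
  obtain ⟨v, hv⟩ := exists_mulVec_eq_one hσ i
  let f : (Fin d → ℤ) →ₗ[ℤ] ℤ := (LinearMap.proj i).comp σ.mulVecLin
  have hfv : f v = 1 := hv
  -- A basis of the kernel together with `v` is a basis, as `f` splits.
  let b₀ := Module.finBasis ℤ (LinearMap.ker f)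
  let b := Module.Basis.mkFinCons v b₀ (fun c x hx h => by
      have := congrArg f h
      rw [map_add, map_smul, LinearMap.mem_ker.1 hx, hfv] at this
      simpa using this)
    (fun z => ⟨-f z, by rw [LinearMap.mem_ker, map_add, map_smul, hfv]; simp⟩)
  have hcard : Module.finrank ℤ (LinearMap.ker f) + 1 = d := by
    have := Module.finrank_eq_card_basis b
    simpa using this.symm
  have hb0 : f (b 0) = 1 := by simp [b, hfv]
  have hbs : ∀ k, f (b (Fin.succ k)) = 0 := fun k => by
    simp only [b, Module.Basis.coe_mkFinCons, Fin.cons_succ]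
    exact LinearMap.mem_ker.1 (b₀ k).2
  have hb : ∀ k, 0 ≤ f (b k) := fun k => by
    refine Fin.cases ?_ (fun k => ?_) k
    · rw [hb0]; exact zero_le_one
    · rw [hbs]
  have hre : ∀ k, b.reindex (finCongr hcard) k = b ((finCongr hcard).symm k) := fun k => by simp
  refine ⟨b.reindex (finCongr hcard), fun k => ?_, ?_⟩
  · rw [hre]
    exact hb _
  · simp only [hre]
    refine ((finCongr hcard).symm.sum_comp fun k => f (b k)).trans ?_
    rw [Fin.sum_univ_succ, hb0, Finset.sum_eq_zero fun k _ => hbs k, add_zero]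

end Geometry

/-! ### Monomials and the Laurent polynomial ring -/

section Laurent

/-- The multiplicative set of monomials in a monoid algebra. -/
def monomials (K A : Type*) [Semiring K] [AddMonoid A] : Submonoid (AddMonoidAlgebra K A) :=
  MonoidHom.mrange (AddMonoidAlgebra.of K A)

theorem single_mem_monomials (K : Type*) {A : Type*} [Semiring K] [AddMonoid A] (a : A) :
    AddMonoidAlgebra.single a (1 : K) ∈ monomials K A :=
  ⟨Multiplicative.ofAdd a, rfl⟩

/-- Inverting the monomials of the algebra of a cancellative monoid gives the algebra of its group
of differences. -/
theorem isLocalization_monomials {K A G : Type*} [Field K] [AddCommMonoid A] [AddCommGroup G]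
    [Algebra (AddMonoidAlgebra K A) (AddMonoidAlgebra K G)] (φ : A →+ G)
    (hφ : Function.Injective φ)
    (halg : algebraMap (AddMonoidAlgebra K A) (AddMonoidAlgebra K G) =
      AddMonoidAlgebra.mapDomainRingHom K φ)
    (hgen : ∀ g, ∃ a b, g + φ b = φ a) :
    IsLocalization (monomials K A) (AddMonoidAlgebra K G) := by
  have hs : ∀ (a : A) (r : K), algebraMap (AddMonoidAlgebra K A) (AddMonoidAlgebra K G)
      (AddMonoidAlgebra.single a r) = AddMonoidAlgebra.single (φ a) r := fun a r => by
    rw [halg, AddMonoidAlgebra.mapDomainRingHom_apply, AddMonoidAlgebra.mapDomain_single]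
  rw [isLocalization_iff]
  refine ⟨?_, ?_, ?_⟩
  · rintro ⟨_, a, rfl⟩
    change IsUnit (algebraMap _ _ (AddMonoidAlgebra.single a.toAdd 1))
    rw [hs]
    refine IsUnit.of_mul_eq_one (AddMonoidAlgebra.single (-φ a.toAdd) 1) ?_
    rw [AddMonoidAlgebra.single_mul_single, add_neg_cancel, mul_one]
    rfl
  · intro z
    induction z using AddMonoidAlgebra.induction_linear with
    | zero => exact ⟨(0, 1), by simp⟩
    | add x y hx hy =>
      obtain ⟨⟨p, m⟩, hp⟩ := hx
      obtain ⟨⟨q, n⟩, hq⟩ := hy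
      refine ⟨(p * n + q * m, m * n), ?_⟩
      simp only [Submonoid.coe_mul, map_mul, map_add] at hp hq ⊢
      rw [← hp, ← hq]; ring
    | single g r =>
      obtain ⟨a, b, hab⟩ := hgen g
      refine ⟨(AddMonoidAlgebra.single a r,
        ⟨AddMonoidAlgebra.single b 1, single_mem_monomials K b⟩), ?_⟩
      simp only [hs, AddMonoidAlgebra.single_mul_single, hab, mul_one]
  · intro x y h
    rw [halg] at h
    exact ⟨1, by rw [AddMonoidAlgebra.mapDomain_injective hφ h]⟩

/-- The Laurent polynomial ring is a localization of the polynomial ring. -/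
theorem laurentRing_uniqueFactorizationMonoid (K : Type*) [Field K] (d : ℕ) :
    UniqueFactorizationMonoid (LaurentRing K d) := by
  let φ : (Fin d →₀ ℕ) →+ (Fin d → ℤ) :=
    { toFun := fun f i => (f i : ℤ)
      map_zero' := by funext i; simp
      map_add' := fun f g => by funext i; simp }
  let : Algebra (MvPolynomial (Fin d) K) (LaurentRing K d) :=
    (AddMonoidAlgebra.mapDomainRingHom K φ).toAlgebra
  have := isLocalization_monomials (K := K) φ
    (fun f g h => by ext i; have := congrFun h i; simpa [φ] using this) rfl
    (fun g => ⟨Finsupp.equivFunOnFinite.symm fun i => (g i).toNat,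
      Finsupp.equivFunOnFinite.symm fun i => (-g i).toNat, by
        funext i
        simp only [φ, AddMonoidHom.coe_mk, ZeroHom.coe_mk, Pi.add_apply,
          Finsupp.equivFunOnFinite_symm_apply_apply]
        omega⟩)
  exact UniqueFactorizationMonoid.of_isLocalization (monomials K (Fin d →₀ ℕ)) _

variable {K : Type*} [Field K] {d s : ℕ} {M : AddSubmonoid (Fin d → ℤ)}
  {σ : Matrix (Fin s) (Fin d) ℤ}

theorem algebraMap_single (m : M) (r : K) :
    algebraMap (MonoidRing K M) (LaurentRing K d) (AddMonoidAlgebra.single m r) =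
      AddMonoidAlgebra.single (m : Fin d → ℤ) r := by
  change AddMonoidAlgebra.mapDomainRingHom K M.subtype _ = _
  rw [AddMonoidAlgebra.mapDomainRingHom_apply, AddMonoidAlgebra.mapDomain_single]
  rfl

theorem algebraMap_laurent_injective :
    Function.Injective (algebraMap (MonoidRing K M) (LaurentRing K d)) :=
  AddMonoidAlgebra.mapDomain_injective Subtype.coe_injective

theorem single_smul (m : M) (r : K) (f : LaurentRing K d) :
    (AddMonoidAlgebra.single m r : MonoidRing K M) • f =
      AddMonoidAlgebra.single (m : Fin d → ℤ) r * f := by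
  rw [Algebra.smul_def, algebraMap_single]

theorem single_ne_zero' (z : Fin d → ℤ) : (AddMonoidAlgebra.single z 1 : LaurentRing K d) ≠ 0 :=
  fun h => by
    have := congrArg (fun f : LaurentRing K d => f.coeff z) h
    simp at this

theorem single_mul_single_neg (z : Fin d → ℤ) :
    (AddMonoidAlgebra.single z 1 * AddMonoidAlgebra.single (-z) 1 : LaurentRing K d) = 1 := by
  rw [AddMonoidAlgebra.single_mul_single, add_neg_cancel, mul_one]
  rfl

theorem exists_coeff_ne_zero {f : LaurentRing K d} (hf : f ≠ 0) : ∃ z, f.coeff z ≠ 0 := by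
  by_contra! h
  exact hf (AddMonoidAlgebra.coeff_injective (Finsupp.ext h))

theorem exists_add_eq_of_coeff_mul_ne_zero {f g : LaurentRing K d} {z : Fin d → ℤ}
    (h : (f * g).coeff z ≠ 0) : ∃ a b, f.coeff a ≠ 0 ∧ g.coeff b ≠ 0 ∧ a + b = z := by
  classical
  by_contra! hcon
  refine h ?_
  rw [AddMonoidAlgebra.coeff_mul]
  refine Finset.sum_eq_zero fun a ha => Finset.sum_eq_zero fun b hb => ?_
  exact if_neg (hcon a b (Finsupp.mem_support_iff.1 ha) (Finsupp.mem_support_iff.1 hb))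

/-- The sum of the lowest exponents of two Laurent polynomials, with respect to a linear
preorder given by an integral form refined by the lexicographic order, is an exponent of the
product. -/
theorem exists_lowest_term (i : Fin s) {f g : LaurentRing K d} (hf : f ≠ 0) (hg : g ≠ 0) :
    ∃ a b, f.coeff a ≠ 0 ∧ g.coeff b ≠ 0 ∧ (f * g).coeff (a + b) ≠ 0 ∧
      (∀ z, f.coeff z ≠ 0 → σ.mulVec a i ≤ σ.mulVec z i) ∧
      ∀ z, g.coeff z ≠ 0 → σ.mulVec b i ≤ σ.mulVec z i := by
  classical
  -- `κ` embeds `ℤ^d` into a linearly ordered group, and its order refines the values of `σ_i`.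
  let κ : (Fin d → ℤ) → ℤ ×ₗ Lex (Fin d → ℤ) := fun z => toLex (σ.mulVec z i, toLex z)
  have hκadd : ∀ x y, κ (x + y) = κ x + κ y := fun x y => by
    simp only [κ, Matrix.mulVec_add]; rfl
  have hκinj : Function.Injective κ := fun x y h => by
    have := congrArg (fun p => (ofLex p).2) h
    exact this
  have hκle : ∀ x y, κ x ≤ κ y → σ.mulVec x i ≤ σ.mulVec y i := fun x y h => by
    rcases Prod.Lex.le_iff.1 h with h | h
    · exact h.le
    · exact h.1.le
  have hex : ∀ h : LaurentRing K d, h ≠ 0 → ∃ a, h.coeff a ≠ 0 ∧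
      ∀ z, h.coeff z ≠ 0 → κ a ≤ κ z := by
    intro h hh
    obtain ⟨z, hz⟩ := exists_coeff_ne_zero hh
    obtain ⟨a, ha, hmin⟩ := Finset.exists_min_image h.coeff.support κ
      ⟨z, Finsupp.mem_support_iff.2 hz⟩
    exact ⟨a, Finsupp.mem_support_iff.1 ha, fun z hz => hmin z (Finsupp.mem_support_iff.2 hz)⟩
  obtain ⟨a, ha, hamin⟩ := hex f hf
  obtain ⟨b, hb, hbmin⟩ := hex g hg
  refine ⟨a, b, ha, hb, ?_, fun z hz => hκle _ _ (hamin z hz), fun z hz => hκle _ _ (hbmin z hz)⟩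
  rw [AddMonoidAlgebra.coeff_mul_add_of_uniqueAdd]
  · exact mul_ne_zero ha hb
  · -- The exponents that are minimal for `κ` form the only pair with their sum.
    intro x y hx hy hxy
    have h1 := hamin x (Finsupp.mem_support_iff.1 hx)
    have h2 := hbmin y (Finsupp.mem_support_iff.1 hy)
    have h3 : κ x + κ y = κ a + κ b := by rw [← hκadd, ← hκadd, hxy]
    have h4 : κ x = κ a := le_antisymm
      (le_of_add_le_add_right (a := κ y) (by rw [h3]; exact add_le_add le_rfl h2)) h1
    refine ⟨hκinj h4, hκinj ?_⟩
    rw [h4] at h3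
    exact add_left_cancel h3

variable (K M σ) in
/-- The ideal `𝒟(u)` for an integral vector `u`. -/
abbrev latticeIdeal (u : Fin s → ℤ) : Submodule (MonoidRing K M) (LaurentRing K d) :=
  divisorialMonomialIdeal K M σ (realVec u)

variable (hM : IsPositiveNormalAffine M) (hσ : IsIrredundantRepresentation M σ)

include hσ in
theorem mem_latticeIdeal {u : Fin s → ℤ} {f : LaurentRing K d} :
    f ∈ latticeIdeal K M σ u ↔ ∀ z, f.coeff z ≠ 0 → u ≤ σ.mulVec z := by
  rw [mem_divisorialMonomialIdeal K M hσ]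
  simp only [realMap_realVec, realVec_le]

include hσ in
theorem single_mem_latticeIdeal {u : Fin s → ℤ} {z : Fin d → ℤ} (hz : u ≤ σ.mulVec z) :
    (AddMonoidAlgebra.single z 1 : LaurentRing K d) ∈ latticeIdeal K M σ u := by
  rw [mem_latticeIdeal hσ]
  intro w hw
  rw [AddMonoidAlgebra.coeff_single, Finsupp.single_apply] at hw
  by_cases h : z = w
  · exact h ▸ hz
  · simp [h] at hw

include hσ in
theorem mul_mem_latticeIdeal {u v : Fin s → ℤ} {f g : LaurentRing K d}
    (hf : f ∈ latticeIdeal K M σ u) (hg : g ∈ latticeIdeal K M σ v) :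
    f * g ∈ latticeIdeal K M σ (u + v) := by
  rw [mem_latticeIdeal hσ] at hf hg ⊢
  intro z hz
  obtain ⟨a, b, ha, hb, rfl⟩ := exists_add_eq_of_coeff_mul_ne_zero hz
  rw [Matrix.mulVec_add]
  exact add_le_add (hf a ha) (hg b hb)

include hM hσ in
theorem mem_latticeIdeal_zero {f : LaurentRing K d} :
    f ∈ latticeIdeal K M σ 0 ↔ ∃ r, algebraMap (MonoidRing K M) (LaurentRing K d) r = f := by
  constructor
  · rw [mem_latticeIdeal hσ]
    intro hf
    rw [← AddMonoidAlgebra.sum_coeff_single f]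
    refine Subring.sum_mem (algebraMap (MonoidRing K M) (LaurentRing K d)).range fun z hz => ?_
    exact ⟨AddMonoidAlgebra.single
      ⟨z, (mem_monoid_iff hM hσ).2 (hf z (Finsupp.mem_support_iff.1 hz))⟩ _,
      algebraMap_single _ _⟩
  · rintro ⟨r, rfl⟩
    rw [Algebra.algebraMap_eq_smul_one]
    exact Submodule.smul_mem _ _ (single_mem_latticeIdeal hσ (z := 0) (by simp))

include hM hσ in
/-- The colon ideal of lattice ideals: it suffices to test monomials, and the bounds are attained
on the lattice points. -/
theorem mem_latticeIdeal_of_forall_mul_single_mem {u v : Fin s → ℤ} {f : LaurentRing K d}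
    (h : ∀ z, u ≤ σ.mulVec z → f * AddMonoidAlgebra.single z 1 ∈ latticeIdeal K M σ v) :
    f ∈ latticeIdeal K M σ (v - u) := by
  rw [mem_latticeIdeal hσ]
  intro w hw i
  obtain ⟨z, hz, hzi⟩ := exists_attain hM hσ u i
  have h1 := (mem_latticeIdeal hσ).1 (h z hz) (w + z) (by
    rw [AddMonoidAlgebra.coeff_mul_single_apply, mul_one]; simpa using hw) i
  rw [Matrix.mulVec_add, Pi.add_apply, hzi] at h1
  rw [Pi.sub_apply]
  linarith

include hσ in
theorem mul_single_mem_latticeIdeal {u : Fin s → ℤ} {f : LaurentRing K d}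
    (hf : f ∈ latticeIdeal K M σ u) (z : Fin d → ℤ) :
    f * AddMonoidAlgebra.single z 1 ∈ latticeIdeal K M σ (u + σ.mulVec z) :=
  mul_mem_latticeIdeal hσ hf (single_mem_latticeIdeal hσ le_rfl)

variable (K) in
include hM hσ in
theorem isLocalization_laurentRing : IsLocalization (monomials K M) (LaurentRing K d) := by
  refine isLocalization_monomials M.subtype Subtype.coe_injective rfl fun g => ?_
  obtain ⟨a, ha, hag⟩ := exists_translate_mem hM hσ (fun _ : Unit => g)
  exact ⟨⟨a + g, hag ()⟩, ⟨a, ha⟩, add_comm _ _⟩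

theorem monoidRing_isNoetherianRing (hM : IsPositiveNormalAffine M) :
    IsNoetherianRing (MonoidRing K M) := by
  have : AddMonoid.FG M := (AddMonoid.fg_iff_addSubmonoid_fg M).2 hM.fg
  exact Algebra.FiniteType.isNoetherianRing K _

end Laurent

/-! ### Divisor classes of modules -/

section Classes

variable {A : Type*} [CommRing A] [IsDomain A]

theorem spanSingleton_mul_inv (x : (FractionRing A)ˣ) {I : FractionalIdeal A⁰ (FractionRing A)}
    (hI : I ≠ 0) : (FractionalIdeal.spanSingleton A⁰ (x : FractionRing A) * I)⁻¹ =
      FractionalIdeal.spanSingleton A⁰ ((x⁻¹ : (FractionRing A)ˣ) : FractionRing A) * I⁻¹ := by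
  ext y
  rw [FractionalIdeal.mem_inv_iff (DivisorialIdeal.mul_ne_zero'
    (FractionalIdeal.spanSingleton_ne_zero_iff.2 x.ne_zero) hI),
    FractionalIdeal.mem_singleton_mul]
  constructor
  · intro h
    refine ⟨x * y, (FractionalIdeal.mem_inv_iff hI).2 fun z hz => ?_, by simp⟩
    have := h (x * z) (FractionalIdeal.mem_singleton_mul.2 ⟨z, hz, rfl⟩)
    rwa [← mul_assoc, mul_comm y] at this
  · rintro ⟨w, hw, rfl⟩ z hz
    obtain ⟨t, ht, rfl⟩ := FractionalIdeal.mem_singleton_mul.1 hz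
    have := (FractionalIdeal.mem_inv_iff hI).1 hw t ht
    convert this using 1
    rw [mul_mul_mul_comm, Units.inv_mul, one_mul]

theorem principal_mul_val (x : (FractionRing A)ˣ) (I : DivisorialIdeal A) :
    (DivisorialIdeal.principal A x * I).val =
      FractionalIdeal.spanSingleton A⁰ (x : FractionRing A) * I.val := by
  rw [DivisorialIdeal.val_mul]
  change (FractionalIdeal.spanSingleton A⁰ (x : FractionRing A) * I.val)⁻¹⁻¹ = _
  rw [spanSingleton_mul_inv x I.ne_zero, spanSingleton_mul_inv _
    (DivisorialIdeal.inv_ne_zero' I.ne_zero), I.inv_inv_eq, inv_inv]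

theorem divisorClass_eq_iff {I J : (DivisorialIdeal A)ˣ} :
    DivisorClassGroup.mk I = DivisorClassGroup.mk J ↔ ∃ x : (FractionRing A)ˣ,
      (J : DivisorialIdeal A).val = FractionalIdeal.spanSingleton A⁰ (x : FractionRing A) *
        (I : DivisorialIdeal A).val := by
  have h1 : DivisorClassGroup.mk I = DivisorClassGroup.mk J ↔
      I⁻¹ * J ∈ (DivisorialIdeal.principal A).toHomUnits.range := QuotientGroup.eq
  rw [h1]
  constructor
  · rintro ⟨x, hx⟩
    refine ⟨x, ?_⟩
    rw [← principal_mul_val]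
    have h2 : J = (DivisorialIdeal.principal A).toHomUnits x * I := by
      rw [hx, mul_comm I⁻¹, mul_assoc, inv_mul_cancel, mul_one]
    rw [h2]
    rfl
  · rintro ⟨x, hx⟩
    refine ⟨x, ?_⟩
    rw [eq_inv_mul_iff_mul_eq, mul_comm]
    refine Units.ext (DivisorialIdeal.ext ?_)
    rw [hx, ← principal_mul_val]
    rfl

theorem divisorClass_eq_zero_iff {I : (DivisorialIdeal A)ˣ} :
    DivisorClassGroup.mk I = 0 ↔ ∃ x : (FractionRing A)ˣ,
      (I : DivisorialIdeal A).val =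
        FractionalIdeal.spanSingleton A⁰ (x : FractionRing A) := by
  have h : (0 : DivisorClassGroup A) = DivisorClassGroup.mk 1 := rfl
  rw [h, eq_comm, divisorClass_eq_iff, Units.val_one, DivisorialIdeal.val_one]
  simp only [mul_one]

/-- An isomorphism of fractional ideals is the multiplication by an element of the field of
fractions. -/
theorem eq_spanSingleton_mul_of_linearEquiv {I J : FractionalIdeal A⁰ (FractionRing A)}
    (hI : I ≠ 0) (e : (I : Submodule A (FractionRing A)) ≃ₗ[A] (J : Submodule A (FractionRing A))) :
    ∃ x : (FractionRing A)ˣ, J = FractionalIdeal.spanSingleton A⁰ (x : FractionRing A) * I := by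
  have h0 := hI
  rw [Ne, FractionalIdeal.eq_zero_iff] at h0
  push Not at h0
  obtain ⟨a, ha, ha0⟩ := h0
  obtain ⟨r, hr, hrI⟩ := I.isFractional
  have hr0 : algebraMap A (FractionRing A) r ≠ 0 :=
    IsFractionRing.to_map_ne_zero_of_mem_nonZeroDivisors hr
  have key : ∀ b (hb : b ∈ (I : Submodule A (FractionRing A))),
      b * (e ⟨a, ha⟩ : FractionRing A) = a * (e ⟨b, hb⟩ : FractionRing A) := by
    intro b hb
    obtain ⟨p, hp⟩ := hrI a ha
    obtain ⟨q, hq⟩ := hrI b hb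
    have h1 : q • (⟨a, ha⟩ : (I : Submodule A (FractionRing A))) = p • ⟨b, hb⟩ := by
      refine Subtype.ext ?_
      change q • a = p • b
      rw [Algebra.smul_def, Algebra.smul_def, hp, hq, Algebra.smul_def, Algebra.smul_def]
      ring
    have h2 := congrArg (fun w => (e w : FractionRing A)) h1
    simp only [map_smul, SetLike.val_smul, Algebra.smul_def, hp, hq] at h2
    rw [mul_assoc, mul_assoc] at h2
    exact mul_left_cancel₀ hr0 h2
  have hea : (e ⟨a, ha⟩ : FractionRing A) ≠ 0 := by
    intro h
    have : e ⟨a, ha⟩ = 0 := Subtype.ext h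
    exact ha0 (congrArg Subtype.val ((LinearEquiv.map_eq_zero_iff e).1 this))
  refine ⟨Units.mk0 (e ⟨a, ha⟩ / a) (div_ne_zero hea ha0), ?_⟩
  have hmul : ∀ b (hb : b ∈ (I : Submodule A (FractionRing A))),
      (e ⟨b, hb⟩ : FractionRing A) = e ⟨a, ha⟩ / a * b := fun b hb => by
    rw [div_mul_eq_mul_div, eq_div_iff ha0, mul_comm _ b, key b hb, mul_comm]
  ext y
  rw [FractionalIdeal.mem_singleton_mul]
  constructor
  · intro hy
    refine ⟨e.symm ⟨y, hy⟩, (e.symm ⟨y, hy⟩).2, ?_⟩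
    rw [Units.val_mk0, ← hmul _ (e.symm ⟨y, hy⟩).2]
    simp
  · rintro ⟨b, hb, rfl⟩
    rw [Units.val_mk0, ← hmul b hb]
    exact (e ⟨b, hb⟩).2

/-- The class of a module is unique if it exists. -/
theorem HasDivisorClass.unique {N : Type*} [AddCommGroup N] [Module A N]
    {c c' : DivisorClassGroup A} (h : HasDivisorClass N c) (h' : HasDivisorClass N c') :
    c = c' := by
  obtain ⟨I, rfl, ⟨e⟩⟩ := h
  obtain ⟨J, rfl, ⟨e'⟩⟩ := h'
  exact divisorClass_eq_iff.2
    (eq_spanSingleton_mul_of_linearEquiv (I : DivisorialIdeal A).ne_zero (e.symm.trans e'))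

theorem HasDivisorClass.congr {N N' : Type*} [AddCommGroup N] [Module A N] [AddCommGroup N']
    [Module A N'] {c : DivisorClassGroup A} (h : HasDivisorClass N c) (e : N' ≃ₗ[A] N) :
    HasDivisorClass N' c := by
  obtain ⟨I, hI, ⟨f⟩⟩ := h
  exact ⟨I, hI, ⟨e.trans f⟩⟩

end Classes

/-! ### The divisor class group of a normal affine monoid algebra -/

section ClassGroup

variable {K : Type*} [Field K] {d s : ℕ} {M : AddSubmonoid (Fin d → ℤ)}
  {σ : Matrix (Fin s) (Fin d) ℤ}

section Embedding

variable (K M) [IsLocalization (monomials K M) (LaurentRing K d)]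

/-- The embedding of the Laurent polynomial ring into the field of fractions of `K[M]`. -/
def toFractionRing : LaurentRing K d →ₐ[MonoidRing K M] FractionRing (MonoidRing K M) :=
  IsLocalization.liftAlgHom (M := monomials K M)
    (f := Algebra.ofId (MonoidRing K M) (FractionRing (MonoidRing K M))) fun y => by
      obtain ⟨⟨_, a, rfl⟩, rfl⟩ : ∃ y', y' = y := ⟨y, rfl⟩
      have hne : (AddMonoidAlgebra.single a.toAdd 1 : MonoidRing K M) ≠ 0 := fun h => by
        have := congrArg (fun f : MonoidRing K M => f.coeff a.toAdd) h
        simp at this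
      exact IsUnit.mk0 _ (show algebraMap (MonoidRing K M) (FractionRing (MonoidRing K M)) _ ≠ 0
        from IsFractionRing.to_map_eq_zero_iff.not.2 hne)

theorem toFractionRing_algebraMap (r : MonoidRing K M) :
    toFractionRing K M (algebraMap _ _ r) = algebraMap _ _ r :=
  (toFractionRing K M).commutes r

theorem toFractionRing_injective : Function.Injective (toFractionRing K M) := by
  rw [injective_iff_map_eq_zero]
  intro f hf
  obtain ⟨⟨p, q⟩, h⟩ := IsLocalization.surj (monomials K M) f
  have h1 := congrArg (toFractionRing K M) h
  rw [map_mul, hf, zero_mul, toFractionRing_algebraMap, eq_comm,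
    IsFractionRing.to_map_eq_zero_iff] at h1
  rw [h1, map_zero] at h
  exact (IsLocalization.map_units (LaurentRing K d) q).mul_left_eq_zero.1 h

end Embedding

theorem latticeIdeal_anti (hσ : IsIrredundantRepresentation M σ) {u v : Fin s → ℤ} (h : v ≤ u) :
    latticeIdeal K M σ u ≤ latticeIdeal K M σ v := fun f hf => by
  rw [mem_latticeIdeal hσ] at hf ⊢
  exact fun z hz => h.trans (hf z hz)

variable (hM : IsPositiveNormalAffine M) (hσ : IsIrredundantRepresentation M σ)
  [IsLocalization (monomials K M) (LaurentRing K d)]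

/-- A monomial in the interior of the cone, raised to a high power, is a common denominator. -/
theorem isFractional_latticeIdeal (hM : IsPositiveNormalAffine M)
    (hσ : IsIrredundantRepresentation M σ) (u : Fin s → ℤ) : IsFractional (MonoidRing K M)⁰
    ((latticeIdeal K M σ u).map (toFractionRing K M).toLinearMap) := by
  obtain ⟨a, ha⟩ := exists_le_mulVec hM hσ (fun i => |u i|)
  have haM : a ∈ M := (mem_monoid_iff hM hσ).2 fun i => (abs_nonneg _).trans (ha i)
  refine ⟨AddMonoidAlgebra.single ⟨a, haM⟩ 1, mem_nonZeroDivisors_of_ne_zero fun h => ?_, ?_⟩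
  · have := congrArg (fun f : MonoidRing K M => f.coeff ⟨a, haM⟩) h
    simp at this
  · rintro _ ⟨f, hf, rfl⟩
    have h1 := mul_mem_latticeIdeal hσ (single_mem_latticeIdeal (K := K) hσ (z := a) le_rfl) hf
    have h2 : (0 : Fin s → ℤ) ≤ σ.mulVec a + u := fun i => by
      have := ha i
      rw [Pi.add_apply, Pi.zero_apply]
      linarith [neg_abs_le (u i)]
    obtain ⟨r, hr⟩ := (mem_latticeIdeal_zero hM hσ).1 (latticeIdeal_anti hσ h2 h1)
    refine ⟨r, ?_⟩
    rw [← toFractionRing_algebraMap, hr, AlgHom.toLinearMap_apply, ← map_smul, single_smul]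

variable (K) in
/-- The ideal `𝒟(u)`, for `u ∈ ℤ^s`, as a fractional ideal in the field of fractions. -/
def latticeFractionalIdeal (hM : IsPositiveNormalAffine M)
    (hσ : IsIrredundantRepresentation M σ) (u : Fin s → ℤ) :
    FractionalIdeal (MonoidRing K M)⁰ (FractionRing (MonoidRing K M)) :=
  ⟨_, isFractional_latticeIdeal hM hσ u⟩

theorem mem_latticeFractionalIdeal {u : Fin s → ℤ} {x : FractionRing (MonoidRing K M)} :
    x ∈ latticeFractionalIdeal K hM hσ u ↔
      ∃ f ∈ latticeIdeal K M σ u, toFractionRing K M f = x := Iff.rfl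

theorem toFractionRing_mem {u : Fin s → ℤ} {f : LaurentRing K d} :
    toFractionRing K M f ∈ latticeFractionalIdeal K hM hσ u ↔ f ∈ latticeIdeal K M σ u := by
  rw [mem_latticeFractionalIdeal]
  constructor
  · rintro ⟨g, hg, h⟩
    rwa [← toFractionRing_injective K M h]
  · exact fun h => ⟨f, h, rfl⟩

theorem latticeFractionalIdeal_zero : latticeFractionalIdeal K hM hσ 0 = 1 := by
  ext x
  rw [mem_latticeFractionalIdeal, FractionalIdeal.mem_one_iff]
  simp only [mem_latticeIdeal_zero hM hσ]
  constructor
  · rintro ⟨_, ⟨r, rfl⟩, rfl⟩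
    exact ⟨r, (toFractionRing_algebraMap K M r).symm⟩
  · rintro ⟨r, rfl⟩
    exact ⟨_, ⟨r, rfl⟩, toFractionRing_algebraMap K M r⟩

theorem latticeFractionalIdeal_ne_zero (u : Fin s → ℤ) :
    latticeFractionalIdeal K hM hσ u ≠ 0 := by
  obtain ⟨z, hz⟩ := exists_le_mulVec hM hσ u
  intro h
  have h1 := (toFractionRing_mem hM hσ).2 (single_mem_latticeIdeal (K := K) hσ hz)
  rw [h, FractionalIdeal.mem_zero_iff, map_eq_zero_iff _ (toFractionRing_injective K M)] at h1
  exact single_ne_zero' z h1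

theorem mul_mem_latticeFractionalIdeal {u v : Fin s → ℤ} {x y : FractionRing (MonoidRing K M)}
    (hx : x ∈ latticeFractionalIdeal K hM hσ u) (hy : y ∈ latticeFractionalIdeal K hM hσ v) :
    x * y ∈ latticeFractionalIdeal K hM hσ (u + v) := by
  obtain ⟨f, hf, rfl⟩ := hx
  obtain ⟨g, hg, rfl⟩ := hy
  exact ⟨f * g, mul_mem_latticeIdeal hσ hf hg, map_mul (toFractionRing K M) f g⟩

theorem mem_latticeFractionalIdeal_of_forall_mul_mem {u v : Fin s → ℤ}
    {x : FractionRing (MonoidRing K M)}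
    (h : ∀ y ∈ latticeFractionalIdeal K hM hσ u, x * y ∈ latticeFractionalIdeal K hM hσ v) :
    x ∈ latticeFractionalIdeal K hM hσ (v - u) := by
  obtain ⟨z, hz⟩ := exists_le_mulVec hM hσ u
  obtain ⟨f, -, hf⟩ := h _ ((toFractionRing_mem hM hσ).2 (single_mem_latticeIdeal (K := K) hσ hz))
  have hx : x = toFractionRing K M (f * AddMonoidAlgebra.single (-z) 1) := by
    change toFractionRing K M f = _ at hf
    rw [map_mul, hf, mul_assoc, ← map_mul, single_mul_single_neg, map_one, mul_one]
  rw [hx, toFractionRing_mem]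
  refine mem_latticeIdeal_of_forall_mul_single_mem hM hσ fun w hw => ?_
  have := h _ ((toFractionRing_mem hM hσ).2 (single_mem_latticeIdeal (K := K) hσ hw))
  rwa [hx, ← map_mul, toFractionRing_mem] at this

theorem latticeFractionalIdeal_inv (u : Fin s → ℤ) :
    (latticeFractionalIdeal K hM hσ u)⁻¹ = latticeFractionalIdeal K hM hσ (-u) := by
  ext x
  rw [FractionalIdeal.mem_inv_iff (latticeFractionalIdeal_ne_zero hM hσ u),
    ← latticeFractionalIdeal_zero hM hσ]
  constructor
  · intro h
    rw [← zero_sub]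
    exact mem_latticeFractionalIdeal_of_forall_mul_mem hM hσ h
  · intro h y hy
    rw [← neg_add_cancel u]
    exact mul_mem_latticeFractionalIdeal hM hσ h hy

theorem latticeFractionalIdeal_mul_inv (u v : Fin s → ℤ) :
    (latticeFractionalIdeal K hM hσ u * latticeFractionalIdeal K hM hσ v)⁻¹ =
      latticeFractionalIdeal K hM hσ (-(u + v)) := by
  have hne := DivisorialIdeal.mul_ne_zero' (latticeFractionalIdeal_ne_zero (K := K) hM hσ u)
    (latticeFractionalIdeal_ne_zero hM hσ v)
  refine le_antisymm (fun x hx => ?_) ?_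
  · rw [FractionalIdeal.mem_inv_iff hne, ← latticeFractionalIdeal_zero hM hσ] at hx
    have h : x ∈ latticeFractionalIdeal K hM hσ (0 - v - u) := by
      refine mem_latticeFractionalIdeal_of_forall_mul_mem hM hσ fun y hy => ?_
      refine mem_latticeFractionalIdeal_of_forall_mul_mem hM hσ fun z hz => ?_
      rw [mul_assoc]
      exact hx _ (FractionalIdeal.mul_mem_mul hy hz)
    rwa [zero_sub, ← neg_add', add_comm v] at h
  · rw [DivisorialIdeal.le_inv_iff hne, FractionalIdeal.mul_le]
    intro x hx y hy
    refine FractionalIdeal.mul_induction_on hy (fun a ha b hb => ?_) fun a b ha hb => ?_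
    · rw [← latticeFractionalIdeal_zero hM hσ, ← neg_add_cancel (u + v)]
      exact mul_mem_latticeFractionalIdeal hM hσ hx (mul_mem_latticeFractionalIdeal hM hσ ha hb)
    · rw [mul_add]
      exact FractionalIdeal.mem_coe.1
        (Submodule.add_mem _ (FractionalIdeal.mem_coe.2 ha) (FractionalIdeal.mem_coe.2 hb))

theorem latticeFractionalIdeal_mul_inv_inv (u v : Fin s → ℤ) :
    (latticeFractionalIdeal K hM hσ u * latticeFractionalIdeal K hM hσ v)⁻¹⁻¹ =
      latticeFractionalIdeal K hM hσ (u + v) := by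
  rw [latticeFractionalIdeal_mul_inv, latticeFractionalIdeal_inv, neg_neg]

variable (K) in
/-- The ideals `𝒟(u)`, `u ∈ ℤ^s`, are divisorial and `u ↦ 𝒟(u)` turns addition into the
divisorial product. -/
def latticeDivisorialIdeal (hM : IsPositiveNormalAffine M)
    (hσ : IsIrredundantRepresentation M σ) :
    Multiplicative (Fin s → ℤ) →* DivisorialIdeal (MonoidRing K M) where
  toFun u := ⟨latticeFractionalIdeal K hM hσ u.toAdd, latticeFractionalIdeal_ne_zero hM hσ _, by
    rw [latticeFractionalIdeal_inv, latticeFractionalIdeal_inv, neg_neg]⟩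
  map_one' := DivisorialIdeal.ext (latticeFractionalIdeal_zero hM hσ)
  map_mul' u v := DivisorialIdeal.ext
    (latticeFractionalIdeal_mul_inv_inv hM hσ u.toAdd v.toAdd).symm

variable (K) in
/-- The homomorphism `ℤ^s → Cl(K[M])`, `u ↦ [𝒟(u)]`. -/
def latticeClass (hM : IsPositiveNormalAffine M) (hσ : IsIrredundantRepresentation M σ) :
    (Fin s → ℤ) →+ DivisorClassGroup (MonoidRing K M) :=
  AddMonoidHom.mk' (fun u => DivisorClassGroup.mk
    ((latticeDivisorialIdeal K hM hσ).toHomUnits (Multiplicative.ofAdd u))) fun u v => by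
      rw [ofAdd_add, map_mul]; rfl

theorem hasDivisorClass_latticeIdeal (u : Fin s → ℤ) :
    HasDivisorClass (latticeIdeal K M σ u) (latticeClass K hM hσ u) :=
  ⟨_, rfl, ⟨Submodule.equivMapOfInjective (toFractionRing K M).toLinearMap
    (toFractionRing_injective K M) (latticeIdeal K M σ u)⟩⟩

theorem latticeClass_eq_iff {u v : Fin s → ℤ} :
    latticeClass K hM hσ u = latticeClass K hM hσ v ↔
      ∃ x : (FractionRing (MonoidRing K M))ˣ, latticeFractionalIdeal K hM hσ v =
        FractionalIdeal.spanSingleton _ (x : FractionRing (MonoidRing K M)) *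
          latticeFractionalIdeal K hM hσ u :=
  divisorClass_eq_iff

/-- `𝒟(σ(z))` is generated by the monomial `x^z`. -/
theorem latticeClass_mulVec (z : Fin d → ℤ) : latticeClass K hM hσ (σ.mulVec z) = 0 := by
  rw [← map_zero (latticeClass K hM hσ), eq_comm, latticeClass_eq_iff]
  refine ⟨Units.mk0 (toFractionRing K M (AddMonoidAlgebra.single z 1)) ?_, ?_⟩
  · rw [Ne, map_eq_zero_iff _ (toFractionRing_injective K M)]
    exact single_ne_zero' z
  · ext x
    rw [FractionalIdeal.mem_singleton_mul, Units.val_mk0]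
    constructor
    · rintro ⟨f, hf, rfl⟩
      refine ⟨toFractionRing K M (f * AddMonoidAlgebra.single (-z) 1), ?_, ?_⟩
      · have := mul_single_mem_latticeIdeal hσ hf (-z)
        rw [Matrix.mulVec_neg, add_neg_cancel] at this
        exact (toFractionRing_mem hM hσ).2 this
      · rw [← map_mul, mul_comm f, ← mul_assoc, single_mul_single_neg, one_mul]
        rfl
    · rintro ⟨_, ⟨f, hf, rfl⟩, rfl⟩
      have := mul_single_mem_latticeIdeal hσ hf z
      rw [zero_add] at this
      refine ⟨_, this, ?_⟩
      simp only [AlgHom.toLinearMap_apply, map_mul]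
      exact mul_comm _ _

/-- If `𝒟(u)` is principal then its generator `f` is a unit of `K[ℤ^d]` with `f⁻¹ ∈ 𝒟(-u)`, and
`σ(z) = u` for opposite exponents `z` of `f` and `-z` of `f⁻¹`. -/
theorem exists_mulVec_eq_of_latticeClass_eq_zero {u : Fin s → ℤ}
    (h : latticeClass K hM hσ u = 0) : ∃ z, u = σ.mulVec z := by
  obtain ⟨x, hx⟩ := divisorClass_eq_zero_iff.1 h
  change latticeFractionalIdeal K hM hσ u = _ at hx
  have hmem : (x : FractionRing (MonoidRing K M)) ∈ latticeFractionalIdeal K hM hσ u := by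
    rw [hx]; exact FractionalIdeal.mem_spanSingleton_self _ _
  have hmem' : ((x⁻¹ : (FractionRing (MonoidRing K M))ˣ) : FractionRing (MonoidRing K M)) ∈
      latticeFractionalIdeal K hM hσ (-u) := by
    rw [← latticeFractionalIdeal_inv, hx, FractionalIdeal.spanSingleton_inv,
      Units.val_inv_eq_inv_val]
    exact FractionalIdeal.mem_spanSingleton_self _ _
  obtain ⟨f, hf, hfx⟩ := hmem
  obtain ⟨g, hg, hgx⟩ := hmem'
  have hfg : f * g = 1 := toFractionRing_injective K M (by
    rw [map_mul, map_one]
    exact (congrArg₂ _ hfx hgx).trans (Units.mul_inv x))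
  have hc : (f * g).coeff 0 ≠ 0 := by rw [hfg]; simp [AddMonoidAlgebra.one_def]
  obtain ⟨a, b, ha, hb, hab⟩ := exists_add_eq_of_coeff_mul_ne_zero hc
  have h1 := (mem_latticeIdeal hσ).1 hf a ha
  have h2 := (mem_latticeIdeal hσ).1 hg b hb
  refine ⟨a, le_antisymm h1 ?_⟩
  rw [eq_neg_of_add_eq_zero_right hab, Matrix.mulVec_neg] at h2
  exact neg_le_neg_iff.1 h2

end ClassGroup

/-! ### Every divisorial ideal is isomorphic to a lattice ideal -/

section Surjective

/-- In a factorial domain finitely many elements become coprime, in the strong sense that they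
can be cancelled in divisibilities, after division by their greatest common divisor. -/
theorem exists_extract_gcd {A ι : Type*} [CommRing A] [IsDomain A] [UniqueFactorizationMonoid A]
    {T : Finset ι} {p : ι → A} (hp : ∃ t ∈ T, p t ≠ 0) :
    ∃ (G : A) (q : ι → A), G ≠ 0 ∧ (∀ t ∈ T, p t = G * q t) ∧
      ∀ a b, (∀ t ∈ T, b ∣ a * q t) → b ∣ a := by
  classical
  obtain ⟨instGCD⟩ : Nonempty (NormalizedGCDMonoid A) := inferInstance
  obtain ⟨t₀, ht₀, hpt₀⟩ := hp
  obtain ⟨q, hq, hq1⟩ := Finset.extract_gcd p ⟨t₀, ht₀⟩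
  refine ⟨T.gcd p, q, fun h => hpt₀ (Finset.gcd_eq_zero_iff.1 h t₀ ht₀), hq, fun a b h => ?_⟩
  have := (Finset.dvd_gcd h).trans (Finset.gcd_mul_left' T q a).dvd
  rwa [hq1, mul_one] at this

variable {K : Type*} [Field K] {d s : ℕ} {M : AddSubmonoid (Fin d → ℤ)}
  {σ : Matrix (Fin s) (Fin d) ℤ}
  [IsLocalization (monomials K M) (LaurentRing K d)]

/-- Since `K[ℤ^d]` is factorial, a nonzero finitely generated fractional ideal can be scaled so
that it lies in `K[ℤ^d]` and has greatest common divisor `1` there. -/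
theorem exists_scale_gcd_eq_one
    {I : FractionalIdeal (MonoidRing K M)⁰ (FractionRing (MonoidRing K M))}
    (hI : I ≠ 0) (hfg : (I : Submodule (MonoidRing K M) (FractionRing (MonoidRing K M))).FG) :
    ∃ x : (FractionRing (MonoidRing K M))ˣ,
      (∀ y ∈ I, ∃ f, toFractionRing K M f = x * y) ∧
      ∀ g : FractionRing (MonoidRing K M),
        (∀ y ∈ I, ∃ f, toFractionRing K M f = g * (x * y)) → ∃ f, toFractionRing K M f = g := by
  classical
  have : UniqueFactorizationMonoid (LaurentRing K d) := laurentRing_uniqueFactorizationMonoid K d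
  obtain ⟨T, hT⟩ := hfg
  obtain ⟨r, hr, hrI⟩ := I.isFractional
  have hr0 : algebraMap (MonoidRing K M) (FractionRing (MonoidRing K M)) r ≠ 0 :=
    IsFractionRing.to_map_ne_zero_of_mem_nonZeroDivisors hr
  have hTI : ∀ t ∈ T, t ∈ I := fun t ht => by
    rw [← FractionalIdeal.mem_coe, ← hT]; exact Submodule.subset_span ht
  have hp : ∀ t, ∃ f : LaurentRing K d, t ∈ T →
      toFractionRing K M f = algebraMap _ (FractionRing (MonoidRing K M)) r * t := by
    intro t
    by_cases ht : t ∈ T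
    · obtain ⟨p, hp⟩ := hrI t (hTI t ht)
      exact ⟨algebraMap _ _ p, fun _ => by
        rw [toFractionRing_algebraMap, hp, Algebra.smul_def]⟩
    · exact ⟨0, fun h => absurd h ht⟩
  choose p hp using hp
  have hp0 : ∃ t ∈ T, p t ≠ 0 := by
    by_contra! h0
    refine hI (FractionalIdeal.coeToSubmodule_eq_bot.1 ?_)
    rw [← hT, Submodule.span_eq_bot]
    intro t ht
    have h1 := hp t ht
    rw [h0 t ht, map_zero, eq_comm] at h1
    exact (mul_eq_zero.1 h1).resolve_left hr0
  obtain ⟨G, q, hG, hq, hqdvd⟩ := exists_extract_gcd hp0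
  have hjG : toFractionRing K M G ≠ 0 := by
    rwa [Ne, map_eq_zero_iff _ (toFractionRing_injective K M)]
  have hxt : ∀ t ∈ T, toFractionRing K M (q t) =
      algebraMap _ (FractionRing (MonoidRing K M)) r / toFractionRing K M G * t := by
    intro t ht
    rw [div_mul_eq_mul_div, eq_div_iff hjG, ← hp t ht, hq t ht, map_mul (toFractionRing K M),
      mul_comm]
  refine ⟨Units.mk0 (algebraMap _ _ r / toFractionRing K M G) (div_ne_zero hr0 hjG),
    fun y hy => ?_, fun g hg => ?_⟩
  · rw [← FractionalIdeal.mem_coe, ← hT] at hy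
    refine Submodule.span_induction (p := fun y _ => ∃ f, toFractionRing K M f =
      ((Units.mk0 (algebraMap _ _ r / toFractionRing K M G) (div_ne_zero hr0 hjG) :
        (FractionRing (MonoidRing K M))ˣ) : FractionRing (MonoidRing K M)) * y) ?_ ?_ ?_ ?_ hy
    · intro t ht
      exact ⟨q t, hxt t ht⟩
    · exact ⟨0, by rw [map_zero, mul_zero]⟩
    · rintro a b _ _ ⟨f, hf⟩ ⟨g, hg⟩
      exact ⟨f + g, by rw [map_add, hf, hg, mul_add]⟩
    · rintro c a _ ⟨f, hf⟩
      exact ⟨c • f, by rw [map_smul, hf, mul_smul_comm]⟩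
  · obtain ⟨a, b, hb, rfl⟩ := IsFractionRing.div_surjective (A := MonoidRing K M) g
    have hb0 : algebraMap (MonoidRing K M) (FractionRing (MonoidRing K M)) b ≠ 0 :=
      IsFractionRing.to_map_ne_zero_of_mem_nonZeroDivisors hb
    obtain ⟨f, hf⟩ := hqdvd (algebraMap (MonoidRing K M) (LaurentRing K d) a)
        (algebraMap (MonoidRing K M) (LaurentRing K d) b) fun t ht => by
      obtain ⟨f, hf⟩ := hg t (hTI t ht)
      refine ⟨f, toFractionRing_injective K M ?_⟩
      rw [map_mul (toFractionRing K M), map_mul (toFractionRing K M), hf, Units.val_mk0,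
        ← hxt t ht, toFractionRing_algebraMap, toFractionRing_algebraMap, ← mul_assoc,
        mul_div_cancel₀ _ hb0]
    refine ⟨f, ?_⟩
    rw [eq_div_iff hb0, ← toFractionRing_algebraMap, ← toFractionRing_algebraMap, hf,
      map_mul (toFractionRing K M), mul_comm]

variable (hM : IsPositiveNormalAffine M) (hσ : IsIrredundantRepresentation M σ)

/-- A divisorial ideal contained in `K[ℤ^d]` with greatest common divisor `1` is the ideal `𝒟(u)`
where `u_i` is the least value of `σ_i` on the exponents of its elements. -/
theorem exists_eq_latticeFractionalIdeal
    {J : FractionalIdeal (MonoidRing K M)⁰ (FractionRing (MonoidRing K M))} (hJ : J ≠ 0)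
    (hdiv : J⁻¹⁻¹ = J) (hsub : ∀ y ∈ J, ∃ f, toFractionRing K M f = y)
    (hgcd : ∀ g : FractionRing (MonoidRing K M),
        (∀ y ∈ J, ∃ f, toFractionRing K M f = g * y) → ∃ f, toFractionRing K M f = g) :
    ∃ u, J = latticeFractionalIdeal K hM hσ u := by
  have hmin : ∀ i, ∃ c : ℤ, (∃ f z, toFractionRing K M f ∈ J ∧ f.coeff z ≠ 0 ∧
      σ.mulVec z i = c) ∧ ∀ e : ℤ, (∃ f z, toFractionRing K M f ∈ J ∧ f.coeff z ≠ 0 ∧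
      σ.mulVec z i = e) → c ≤ e := by
    intro i
    refine Int.exists_least_of_bdd ?_ ?_
    · -- The lowest term of a common denominator bounds the values of `σ_i` from below.
      obtain ⟨r, hr, hrJ⟩ := J.isFractional
      have hr0 : algebraMap (MonoidRing K M) (LaurentRing K d) r ≠ 0 := by
        rw [Ne, map_eq_zero_iff _ algebraMap_laurent_injective]
        exact nonZeroDivisors.ne_zero hr
      obtain ⟨a₀, ha₀⟩ := exists_coeff_ne_zero hr0
      refine ⟨-σ.mulVec a₀ i, ?_⟩
      rintro _ ⟨f, z, hf, hz, rfl⟩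
      have hf0 : f ≠ 0 := by rintro rfl; simp at hz
      obtain ⟨p, hp⟩ := hrJ _ hf
      have hpf : algebraMap (MonoidRing K M) (LaurentRing K d) r * f = algebraMap _ _ p :=
        toFractionRing_injective K M (by
          rw [map_mul (toFractionRing K M), toFractionRing_algebraMap, toFractionRing_algebraMap,
            hp, Algebra.smul_def])
      obtain ⟨a, b, ha, hb, hab, hamin, hbmin⟩ := exists_lowest_term (σ := σ) i hr0 hf0
      have h1 : (0 : ℤ) ≤ σ.mulVec (a + b) i :=
        (mem_latticeIdeal hσ).1 ((mem_latticeIdeal_zero hM hσ).2 ⟨p, hpf.symm⟩) _ hab i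
      rw [Matrix.mulVec_add, Pi.add_apply] at h1
      linarith [hamin _ ha₀, hbmin z hz]
    · have h0 := hJ
      rw [Ne, FractionalIdeal.eq_zero_iff] at h0
      push Not at h0
      obtain ⟨y, hy, hy0⟩ := h0
      obtain ⟨f, rfl⟩ := hsub y hy
      have hf0 : f ≠ 0 := by rintro rfl; exact hy0 (map_zero _)
      obtain ⟨z, hz⟩ := exists_coeff_ne_zero hf0
      exact ⟨_, f, z, hy, hz, rfl⟩
  choose u hu humin using hmin
  have hle : J ≤ latticeFractionalIdeal K hM hσ u := by
    intro y hy
    obtain ⟨f, rfl⟩ := hsub y hy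
    exact (toFractionRing_mem hM hσ).2 ((mem_latticeIdeal hσ).2 fun z hz i =>
      humin i _ ⟨f, z, hy, hz, rfl⟩)
  have hinv : J⁻¹ ≤ latticeFractionalIdeal K hM hσ (-u) := by
    intro g hg
    have hg' : ∀ y ∈ J, g * y ∈ latticeFractionalIdeal K hM hσ 0 := fun y hy => by
      rw [latticeFractionalIdeal_zero]
      exact (FractionalIdeal.mem_inv_iff hJ).1 hg y hy
    obtain ⟨γ, rfl⟩ := hgcd g fun y hy => by
      obtain ⟨f, -, hf⟩ := hg' y hy
      exact ⟨f, hf⟩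
    -- Multiply by an element of `J` in which the least value `u_i` is attained.
    refine (toFractionRing_mem hM hσ).2 ((mem_latticeIdeal hσ).2 fun z hz i => ?_)
    obtain ⟨f, w, hf, hw, hwu⟩ := hu i
    have hγ0 : γ ≠ 0 := by rintro rfl; simp at hz
    have hf0 : f ≠ 0 := by rintro rfl; simp at hw
    have h0 := hg' _ hf
    rw [← map_mul (toFractionRing K M), toFractionRing_mem] at h0
    obtain ⟨a, b, ha, hb, hab, hamin, hbmin⟩ := exists_lowest_term (σ := σ) i hγ0 hf0
    have h1 : (0 : ℤ) ≤ σ.mulVec (a + b) i := (mem_latticeIdeal hσ).1 h0 _ hab i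
    rw [Matrix.mulVec_add, Pi.add_apply] at h1
    rw [Pi.neg_apply]
    linarith [hamin z hz, hbmin w hw]
  refine ⟨u, le_antisymm hle ?_⟩
  have := FractionalIdeal.inv_anti_mono (I := J⁻¹) (DivisorialIdeal.inv_ne_zero' hJ)
    (latticeFractionalIdeal_ne_zero hM hσ _) hinv
  rwa [latticeFractionalIdeal_inv, neg_neg, hdiv] at this

/-- Every divisor class is the class of an ideal `𝒟(u)`. -/
theorem latticeClass_surjective : Function.Surjective (latticeClass K hM hσ) := by
  have : IsNoetherianRing (MonoidRing K M) := monoidRing_isNoetherianRing hM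
  intro c
  obtain ⟨I, rfl⟩ : ∃ I, DivisorClassGroup.mk I = c := QuotientGroup.mk_surjective c
  obtain ⟨x, hx1, hx2⟩ := exists_scale_gcd_eq_one (I : DivisorialIdeal (MonoidRing K M)).ne_zero
    (isNoetherian_submodule.1 (FractionalIdeal.isNoetherian
      (I : DivisorialIdeal (MonoidRing K M)).val) _ le_rfl)
  have hval := principal_mul_val x (I : DivisorialIdeal (MonoidRing K M))
  have hmem : ∀ y,
      y ∈ (DivisorialIdeal.principal _ x * (I : DivisorialIdeal (MonoidRing K M))).val ↔
      ∃ z ∈ (I : DivisorialIdeal (MonoidRing K M)).val, y = x * z := fun y => by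
    rw [hval, FractionalIdeal.mem_singleton_mul]
  obtain ⟨u, hu⟩ := exists_eq_latticeFractionalIdeal hM hσ
    (DivisorialIdeal.principal _ x * (I : DivisorialIdeal (MonoidRing K M))).ne_zero
    (DivisorialIdeal.principal _ x * (I : DivisorialIdeal (MonoidRing K M))).inv_inv_eq
    (fun y hy => by
      obtain ⟨z, hz, rfl⟩ := (hmem y).1 hy
      exact hx1 z hz)
    (fun g hg => hx2 g fun y hy => hg _ ((hmem _).2 ⟨y, hy, rfl⟩))
  refine ⟨u, Eq.symm (divisorClass_eq_iff.2 ⟨x, ?_⟩)⟩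
  rw [← hval, hu]
  rfl

end Surjective

/-! ### The canonical module -/

section Canonical

variable {K : Type*} [Field K] {d s : ℕ} {M : AddSubmonoid (Fin d → ℤ)}
  {σ : Matrix (Fin s) (Fin d) ℤ}

instance isScalarTower_laurentRing : IsScalarTower K (MonoidRing K M) (LaurentRing K d) :=
  IsScalarTower.of_algebraMap_eq fun r => (algebraMap_single (0 : M) r).symm

theorem intCast_laurentRing (n : ℤ) :
    (n : LaurentRing K d) = AddMonoidAlgebra.single 0 (n : K) :=
  (map_intCast (algebraMap K (LaurentRing K d)) n).symm

theorem single_eq_smul {A : Type*} (a : A) (r : K) :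
    (AddMonoidAlgebra.single a r : AddMonoidAlgebra K A) = r • AddMonoidAlgebra.single a 1 := by
  rw [AddMonoidAlgebra.smul_single, smul_eq_mul, mul_one]

variable (K M) in
/-- The `K`-linear map `x^m ↦ x^m ⊗ m` from `K[M]` to `K[ℤ^d] ⊗ ℤ^d = K[ℤ^d]^d`. -/
def logLinearMap : MonoidRing K M →ₗ[K] (Fin d → LaurentRing K d) :=
  (Finsupp.linearCombination K (M := Fin d → LaurentRing K d) fun (m : M) (k : Fin d) =>
      (AddMonoidAlgebra.single (m : Fin d → ℤ) ((m : Fin d → ℤ) k : K) : LaurentRing K d)) ∘ₗ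
    (AddMonoidAlgebra.coeffLinearEquiv K).toLinearMap

theorem logLinearMap_single (m : M) (r : K) :
    logLinearMap K M (AddMonoidAlgebra.single m r) =
      fun k => AddMonoidAlgebra.single (m : Fin d → ℤ) (r * ((m : Fin d → ℤ) k : K)) := by
  have h : logLinearMap K M (AddMonoidAlgebra.single m r) =
      r • fun k : Fin d =>
        (AddMonoidAlgebra.single (m : Fin d → ℤ) ((m : Fin d → ℤ) k : K) : LaurentRing K d) :=
    Finsupp.linearCombination_single ..
  rw [h]
  funext k
  rw [Pi.smul_apply, AddMonoidAlgebra.smul_single, smul_eq_mul]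

variable (K M) in
/-- The derivation `x^m ↦ x^m ⊗ m` of `K[M]`; it sends `f` to the coordinates of `df` with respect
to the logarithmic differentials of the coordinates of the torus. -/
def logDerivation : Derivation K (MonoidRing K M) (Fin d → LaurentRing K d) :=
  Derivation.mk' (logLinearMap K M) fun a b => by
    induction a using AddMonoidAlgebra.induction_linear with
    | zero => simp
    | add x y hx hy => rw [add_mul, map_add, hx, hy, map_add, smul_add, add_smul]; abel
    | single m r =>
      induction b using AddMonoidAlgebra.induction_linear with
      | zero => simp
      | add x y hx hy => rw [mul_add, map_add, hx, hy, map_add, smul_add, add_smul]; abel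
      | single n t =>
        rw [AddMonoidAlgebra.single_mul_single, logLinearMap_single, logLinearMap_single,
          logLinearMap_single]
        funext k
        rw [Pi.add_apply, Pi.smul_apply, Pi.smul_apply, single_smul, single_smul,
          AddMonoidAlgebra.single_mul_single, AddMonoidAlgebra.single_mul_single,
          AddSubmonoid.coe_add, add_comm (n : Fin d → ℤ), ← AddMonoidAlgebra.single_add]
        congr 1
        rw [Pi.add_apply]
        push_cast
        ring

theorem logDerivation_single (m : M) (r : K) :
    logDerivation K M (AddMonoidAlgebra.single m r) =
      fun k => AddMonoidAlgebra.single (m : Fin d → ℤ) (r * ((m : Fin d → ℤ) k : K)) :=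
  logLinearMap_single m r

variable (K M) in
/-- The determinant of the coordinates of `d` differentials with respect to the logarithmic
differentials of the coordinates of the torus. -/
def logDet : (Ω[MonoidRing K M⁄K]) [⋀^Fin d]→ₗ[MonoidRing K M] LaurentRing K d :=
  AlternatingMap.compLinearMap
    { MultilinearMap.restrictScalars (MonoidRing K M)
        (Matrix.detRowAlternating (n := Fin d) (R := LaurentRing K d)).toMultilinearMap with
      map_eq_zero_of_eq' := (Matrix.detRowAlternating (n := Fin d)
        (R := LaurentRing K d)).map_eq_zero_of_eq' }
    (logDerivation K M).liftKaehlerDifferential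

theorem logDet_apply (ω : Fin d → Ω[MonoidRing K M⁄K]) : logDet K M ω =
    Matrix.det (Matrix.of fun j k => (logDerivation K M).liftKaehlerDifferential (ω j) k) := rfl

variable (K M) in
/-- The map `⋀^d Ω_{R/K} → K[ℤ^d]` which expresses a form as a multiple of the invariant volume
form of the torus. -/
def volumeCoeff : ⋀[MonoidRing K M]^d (Ω[MonoidRing K M⁄K]) →ₗ[MonoidRing K M] LaurentRing K d :=
  exteriorPower.alternatingMapLinearEquiv (logDet K M)

theorem volumeCoeff_ιMulti (ω : Fin d → Ω[MonoidRing K M⁄K]) :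
    volumeCoeff K M (exteriorPower.ιMulti _ _ ω) = logDet K M ω :=
  exteriorPower.alternatingMapLinearEquiv_apply_ιMulti _ _

/-- If the `ω_j` have coordinates `x^{z_j} ⊗ v_j`, the rows of the determinant are multiples of the
integer vectors `v_j`. -/
theorem logDet_eq_single {ω : Fin d → Ω[MonoidRing K M⁄K]} {z v : Fin d → Fin d → ℤ}
    (h : ∀ j, (logDerivation K M).liftKaehlerDifferential (ω j) =
      fun k => AddMonoidAlgebra.single (z j) (v j k : K)) :
    logDet K M ω = AddMonoidAlgebra.single (∑ j, z j) (((Matrix.of v).det : ℤ) : K) := by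
  have hA : (Matrix.of fun j k => (logDerivation K M).liftKaehlerDifferential (ω j) k) =
      Matrix.of fun j k => (AddMonoidAlgebra.single (z j) 1 : LaurentRing K d) *
        (((Matrix.of v).map (Int.castRingHom (LaurentRing K d))) j k) := by
    ext1 j k
    rw [Matrix.of_apply, Matrix.of_apply, h, Matrix.map_apply, Matrix.of_apply,
      eq_intCast, intCast_laurentRing, AddMonoidAlgebra.single_mul_single, add_zero, one_mul]
  have hprod : (∏ j, (AddMonoidAlgebra.single (z j) 1 : LaurentRing K d)) =
      AddMonoidAlgebra.single (∑ j, z j) 1 := by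
    have := map_prod (AddMonoidAlgebra.of K (Fin d → ℤ))
      (fun j => Multiplicative.ofAdd (z j)) Finset.univ
    rw [← ofAdd_sum] at this
    exact this.symm
  rw [logDet_apply, hA, Matrix.det_mul_column, hprod, ← RingHom.mapMatrix_apply, ← RingHom.map_det,
    eq_intCast, intCast_laurentRing, AddMonoidAlgebra.single_mul_single, add_zero, one_mul]

variable (K M) in
/-- The differentials of the monomials generate `Ω_{R/K}`. -/
theorem span_range_D_single : Submodule.span (MonoidRing K M) (Set.range fun m : M =>
    KaehlerDifferential.D K (MonoidRing K M) (AddMonoidAlgebra.single m 1)) = ⊤ := by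
  rw [eq_top_iff, ← KaehlerDifferential.span_range_derivation K (MonoidRing K M),
    Submodule.span_le]
  rintro _ ⟨f, rfl⟩
  induction f using AddMonoidAlgebra.induction_linear with
  | zero => rw [map_zero]; exact Submodule.zero_mem _
  | add x y hx hy => rw [map_add]; exact Submodule.add_mem _ hx hy
  | single m r =>
    rw [single_eq_smul, Derivation.map_smul, ← algebraMap_smul (MonoidRing K M) r]
    exact Submodule.smul_mem _ _ (Submodule.subset_span ⟨m, rfl⟩)

variable (hM : IsPositiveNormalAffine M) (hσ : IsIrredundantRepresentation M σ)

include hM hσ in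
/-- The forms on `Spec R` vanish along every facet: if all `m_j` lie in a facet, then their
determinant is zero. -/
theorem volumeCoeff_mem (e : ⋀[MonoidRing K M]^d (Ω[MonoidRing K M⁄K])) :
    volumeCoeff K M e ∈ latticeIdeal K M σ 1 := by
  have he : e ∈ Submodule.span (MonoidRing K M)
      (exteriorPower.ιMulti (MonoidRing K M) d '' {a | Set.range a ⊆ Set.range fun m : M =>
        KaehlerDifferential.D K (MonoidRing K M) (AddMonoidAlgebra.single m 1)}) := by
    rw [exteriorPower.ιMulti_span_of_span _ _ _ (span_range_D_single K M)]
    trivial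
  suffices h : Submodule.span (MonoidRing K M)
      (exteriorPower.ιMulti (MonoidRing K M) d '' {a | Set.range a ⊆ Set.range fun m : M =>
        KaehlerDifferential.D K (MonoidRing K M) (AddMonoidAlgebra.single m 1)}) ≤
      (latticeIdeal K M σ 1).comap (volumeCoeff K M) from h he
  rw [Submodule.span_le]
  rintro _ ⟨ω, hω, rfl⟩
  have hω' : ∀ j, ∃ m : M,
      KaehlerDifferential.D K (MonoidRing K M) (AddMonoidAlgebra.single m 1) = ω j :=
    fun j => hω ⟨j, rfl⟩
  choose m hm using hω'
  rw [SetLike.mem_coe, Submodule.mem_comap, volumeCoeff_ιMulti,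
    logDet_eq_single (z := fun j => (m j : Fin d → ℤ)) (v := fun j => (m j : Fin d → ℤ))
      (fun j => by
        rw [← hm, Derivation.liftKaehlerDifferential_comp_D, logDerivation_single]
        simp only [one_mul]), mem_latticeIdeal hσ]
  intro w hw i
  rw [AddMonoidAlgebra.coeff_single, Finsupp.single_apply] at hw
  have hzw : ∑ j, (m j : Fin d → ℤ) = w := by
    by_contra h
    rw [if_neg h] at hw
    exact hw rfl
  rw [if_pos hzw] at hw
  have hnn : ∀ j, 0 ≤ σ.mulVec (m j) i := fun j => (mem_monoid_iff hM hσ).1 (m j).2 i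
  rw [← hzw, Matrix.mulVec_sum, Finset.sum_apply, Pi.one_apply]
  by_contra hlt
  have hle : ∑ j, σ.mulVec (m j) i ≤ 0 := Int.lt_add_one_iff.1 (not_le.1 hlt)
  have h0 : ∀ j, σ.mulVec (m j) i = 0 := fun j =>
    (Finset.sum_eq_zero_iff_of_nonneg fun j _ => hnn j).1
      (le_antisymm hle (Finset.sum_nonneg fun j _ => hnn j)) j (Finset.mem_univ j)
  apply hw
  have hdet : (Matrix.of fun j => (m j : Fin d → ℤ)).det = 0 := by
    refine Matrix.exists_mulVec_eq_zero_iff.1 ⟨σ i, fun hσi => ?_, ?_⟩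
    · have hp := hσ.primitive i
      rw [Finset.gcd_eq_zero_iff.2 fun k _ => congrFun hσi k] at hp
      exact zero_ne_one hp
    · funext j
      rw [Pi.zero_apply, ← h0 j, mulVec_apply]
      exact Finset.sum_congr rfl fun k _ => mul_comm _ _
  rw [hdet, Int.cast_zero]

variable (K) in
/-- The differential `x^{2a+v} · d log x^v` of `K[M]`, where `a ∈ M` and `a + v ∈ M`. -/
def logForm (a b : M) : Ω[MonoidRing K M⁄K] :=
  (AddMonoidAlgebra.single a 1 : MonoidRing K M) •
      KaehlerDifferential.D K (MonoidRing K M) (AddMonoidAlgebra.single b 1) -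
    (AddMonoidAlgebra.single b 1 : MonoidRing K M) •
      KaehlerDifferential.D K (MonoidRing K M) (AddMonoidAlgebra.single a 1)

theorem lift_logForm {a b : M} {v : Fin d → ℤ} (h : (a : Fin d → ℤ) + v = b) :
    (logDerivation K M).liftKaehlerDifferential (logForm K a b) =
      fun k => AddMonoidAlgebra.single ((a : Fin d → ℤ) + b) (v k : K) := by
  rw [logForm, map_sub, map_smul, map_smul, Derivation.liftKaehlerDifferential_comp_D,
    Derivation.liftKaehlerDifferential_comp_D, logDerivation_single, logDerivation_single]
  funext k
  rw [Pi.sub_apply, Pi.smul_apply, Pi.smul_apply, single_smul, single_smul,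
    AddMonoidAlgebra.single_mul_single, AddMonoidAlgebra.single_mul_single,
    add_comm (b : Fin d → ℤ), ← AddMonoidAlgebra.single_sub, ← h]
  congr 1
  rw [Pi.add_apply]
  push_cast
  ring

theorem logDet_logForm {a : M} {b : Fin d → M} {v : Fin d → Fin d → ℤ}
    (h : ∀ j, (a : Fin d → ℤ) + v j = b j) :
    logDet K M (fun j => logForm K a (b j)) =
      AddMonoidAlgebra.single (∑ j, ((a : Fin d → ℤ) + b j)) (((Matrix.of v).det : ℤ) : K) :=
  logDet_eq_single fun j => lift_logForm (h j)

variable (K) in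
/-- The logarithmic differential `d log x^z` on the torus, additive in `z`. -/
def dlog (d : ℕ) : (Fin d → ℤ) →+ Ω[LaurentRing K d⁄K] :=
  AddMonoidHom.mk' (fun z => (AddMonoidAlgebra.single (-z) 1 : LaurentRing K d) •
    KaehlerDifferential.D K (LaurentRing K d) (AddMonoidAlgebra.single z 1)) fun y z => by
      have h : (AddMonoidAlgebra.single (y + z) 1 : LaurentRing K d) =
          AddMonoidAlgebra.single y 1 * AddMonoidAlgebra.single z 1 := by
        rw [AddMonoidAlgebra.single_mul_single, mul_one]
      rw [h, Derivation.leibniz, smul_add, smul_smul, smul_smul,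
        AddMonoidAlgebra.single_mul_single, AddMonoidAlgebra.single_mul_single, mul_one, add_comm,
        neg_add, neg_add_cancel_right, neg_add_cancel_comm]

theorem single_smul_dlog (z : Fin d → ℤ) : (AddMonoidAlgebra.single z 1 : LaurentRing K d) •
    dlog K d z = KaehlerDifferential.D K (LaurentRing K d) (AddMonoidAlgebra.single z 1) := by
  change (AddMonoidAlgebra.single z 1 : LaurentRing K d) •
    (AddMonoidAlgebra.single (-z) 1 : LaurentRing K d) •
      KaehlerDifferential.D K (LaurentRing K d) (AddMonoidAlgebra.single z 1) = _
  rw [smul_smul, single_mul_single_neg, one_smul]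

theorem dlog_eq_sum (z : Fin d → ℤ) : dlog K d z = ∑ k, z k • dlog K d (Pi.single k 1) := by
  conv_lhs => rw [← Finset.univ_sum_single z]
  rw [map_sum]
  refine Finset.sum_congr rfl fun k _ => ?_
  rw [← map_zsmul, ← Pi.single_smul, smul_eq_mul, mul_one]

theorem single_smul_kaehler (m : M) (r : K) (x : Ω[LaurentRing K d⁄K]) :
    (AddMonoidAlgebra.single m r : MonoidRing K M) • x =
      (AddMonoidAlgebra.single (m : Fin d → ℤ) r : LaurentRing K d) • x := by
  rw [← algebraMap_smul (LaurentRing K d), algebraMap_single]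

theorem map_D_single (m : M) :
    KaehlerDifferential.map K K (MonoidRing K M) (LaurentRing K d)
      (KaehlerDifferential.D K _ (AddMonoidAlgebra.single m 1)) =
    (AddMonoidAlgebra.single (m : Fin d → ℤ) 1 : LaurentRing K d) • dlog K d m := by
  rw [KaehlerDifferential.map_D, algebraMap_single, single_smul_dlog]

theorem map_logForm {a b : M} {v : Fin d → ℤ} (h : (a : Fin d → ℤ) + v = b) :
    KaehlerDifferential.map K K (MonoidRing K M) (LaurentRing K d) (logForm K a b) =
      (AddMonoidAlgebra.single ((a : Fin d → ℤ) + b) 1 : LaurentRing K d) • dlog K d v := by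
  rw [logForm, map_sub, map_smul, map_smul, map_D_single, map_D_single,
    single_smul_kaehler, single_smul_kaehler, smul_smul, smul_smul,
    AddMonoidAlgebra.single_mul_single, AddMonoidAlgebra.single_mul_single,
    add_comm (b : Fin d → ℤ), mul_one, ← smul_sub, ← map_sub, ← h, add_sub_cancel_left]

include hM hσ in
/-- After inverting the monomials the differentials `d log x_k` generate `Ω`. -/
theorem exists_smul_eq_sum_logForm {a : M} {b : Fin d → M}
    (h : ∀ j, (a : Fin d → ℤ) + (Pi.single j 1 : Fin d → ℤ) = b j) (ω : Ω[MonoidRing K M⁄K]) :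
    ∃ c ∈ monomials K M, ∃ r : Fin d → MonoidRing K M, c • ω = ∑ j, r j • logForm K a (b j) := by
  have hL := isLocalization_laurentRing K hM hσ
  have hloc := KaehlerDifferential.isLocalizedModule_map K (MonoidRing K M) (LaurentRing K d)
    (monomials K M)
  have hω : ω ∈ Submodule.span (MonoidRing K M) (Set.range fun m : M =>
      KaehlerDifferential.D K (MonoidRing K M) (AddMonoidAlgebra.single m 1)) := by
    rw [span_range_D_single]; trivial
  induction hω using Submodule.span_induction with
  | zero => exact ⟨1, one_mem _, 0, by simp⟩
  | add x y _ _ hx hy =>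
    obtain ⟨c, hc, r, hr⟩ := hx
    obtain ⟨c', hc', r', hr'⟩ := hy
    refine ⟨c * c', mul_mem hc hc', fun j => c' * r j + c * r' j, ?_⟩
    simp only [add_smul, mul_smul, Finset.sum_add_distrib, ← Finset.smul_sum, ← hr, ← hr']
    rw [smul_add, smul_add, ← mul_smul, ← mul_smul, ← mul_smul, mul_comm c c']
  | smul p x _ hx =>
    obtain ⟨c, hc, r, hr⟩ := hx
    refine ⟨c, hc, fun j => p * r j, ?_⟩
    simp only [mul_smul, ← Finset.smul_sum, ← hr]
    rw [smul_comm]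
  | mem x hx =>
    obtain ⟨m, rfl⟩ := hx
    obtain ⟨t, ht, htm⟩ := exists_translate_mem hM hσ
      (fun j => (m : Fin d → ℤ) - ((a : Fin d → ℤ) + b j))
    -- The identity `d log x^m = ∑ m_j d log x_j`, multiplied by `x^{t + m}`, holds in the
    -- localization of `Ω`, hence in `Ω` after multiplication by a further monomial `c`.
    let t' : M := ⟨t, ht⟩
    let q : Fin d → M := fun j => ⟨_, htm j⟩
    have key : KaehlerDifferential.map K K (MonoidRing K M) (LaurentRing K d)
        ((AddMonoidAlgebra.single t' 1 : MonoidRing K M) •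
          KaehlerDifferential.D K (MonoidRing K M) (AddMonoidAlgebra.single m 1)) =
        KaehlerDifferential.map K K (MonoidRing K M) (LaurentRing K d)
          (∑ j, ((m : Fin d → ℤ) j • (AddMonoidAlgebra.single (q j) 1 : MonoidRing K M)) •
            logForm K a (b j)) := by
      rw [map_smul, map_sum, map_D_single, dlog_eq_sum, single_smul_kaehler,
        smul_smul, AddMonoidAlgebra.single_mul_single, Finset.smul_sum]
      refine Finset.sum_congr rfl fun j _ => ?_
      rw [smul_assoc, map_zsmul, map_smul, map_logForm (h j), single_smul_kaehler,
        smul_smul, AddMonoidAlgebra.single_mul_single, smul_comm]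
      have : t + (m : Fin d → ℤ) = (q j : Fin d → ℤ) + ((a : Fin d → ℤ) + b j) := by
        change _ = t + ((m : Fin d → ℤ) - ((a : Fin d → ℤ) + b j)) + _
        abel
      change _ • (AddMonoidAlgebra.single (t + _) _ • _) = _
      rw [this]
    obtain ⟨c, hc⟩ := IsLocalizedModule.exists_of_eq (S := monomials K M) key
    refine ⟨(c : MonoidRing K M) * AddMonoidAlgebra.single t' 1,
      mul_mem c.2 (single_mem_monomials K t'),
      fun j => (c : MonoidRing K M) *
        ((m : Fin d → ℤ) j • (AddMonoidAlgebra.single (q j) 1 : MonoidRing K M)), ?_⟩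
    rw [Finset.sum_congr rfl fun j _ => mul_smul _ _ _, ← Finset.smul_sum, mul_smul]
    exact hc

include hM hσ in
/-- `⋀^d Ω` has rank one: an alternating map on `Ω` is determined by its value on the logarithmic
forms. -/
theorem alternatingMap_ext_of_logForm {a : M} {b : Fin d → M}
    (h : ∀ j, (a : Fin d → ℤ) + (Pi.single j 1 : Fin d → ℤ) = b j)
    {g g' : (Ω[MonoidRing K M⁄K]) [⋀^Fin d]→ₗ[MonoidRing K M] LaurentRing K d}
    (hg : g (fun j => logForm K a (b j)) = g' fun j => logForm K a (b j)) : g = g' := by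
  classical
  refine AlternatingMap.ext fun ω => ?_
  choose c hc r hr using fun j => exists_smul_eq_sum_logForm hM hσ h (ω j)
  -- Pulled back to `R^d` both maps are multiples of the determinant by the same value.
  let Θ : (Fin d → MonoidRing K M) →ₗ[MonoidRing K M] Ω[MonoidRing K M⁄K] :=
    Fintype.linearCombination (MonoidRing K M) fun j => logForm K a (b j)
  have hΘ : g.compLinearMap Θ = g'.compLinearMap Θ := by
    refine Module.Basis.ext_alternating (Pi.basisFun (MonoidRing K M) (Fin d)) fun v hv => ?_
    let π : Equiv.Perm (Fin d) := Equiv.ofBijective v (Finite.injective_iff_bijective.1 hv)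
    have hπ : (fun i => Θ (Pi.basisFun (MonoidRing K M) (Fin d) (v i))) =
        (fun j => logForm K a (b j)) ∘ π := by
      funext i
      simp only [Θ, Pi.basisFun_apply, Fintype.linearCombination_apply_single, one_smul,
        Function.comp]
      rfl
    rw [AlternatingMap.compLinearMap_apply, AlternatingMap.compLinearMap_apply, hπ,
      AlternatingMap.map_perm, AlternatingMap.map_perm, hg]
  have hΘr : (fun j => c j • ω j) = fun j => Θ (r j) := by
    funext j
    rw [hr j, Fintype.linearCombination_apply]
  have h1 : (∏ j, c j) • g ω = (∏ j, c j) • g' ω := by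
    rw [← AlternatingMap.map_smul_univ, ← AlternatingMap.map_smul_univ, hΘr]
    exact congrArg (fun G => G r) hΘ
  rw [Algebra.smul_def, Algebra.smul_def] at h1
  have hL := isLocalization_laurentRing K hM hσ
  have hu := IsLocalization.map_units (LaurentRing K d)
    (⟨∏ j, c j, prod_mem fun j _ => hc j⟩ : monomials K M)
  exact hu.mul_left_cancel h1

theorem volumeCoeff_logForm {a : M} {b : Fin d → M}
    (h : ∀ j, (a : Fin d → ℤ) + (Pi.single j 1 : Fin d → ℤ) = b j) :
    volumeCoeff K M (exteriorPower.ιMulti (MonoidRing K M) d fun j => logForm K a (b j)) =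
      AddMonoidAlgebra.single (∑ j, ((a : Fin d → ℤ) + b j)) 1 := by
  have hdet : (Matrix.of fun j : Fin d => (Pi.single j 1 : Fin d → ℤ)).det = 1 := by
    rw [← Matrix.det_one (n := Fin d) (R := ℤ)]
    congr 1
    ext j k
    simp [Matrix.one_apply, Pi.single_apply, eq_comm]
  rw [volumeCoeff_ιMulti, logDet_logForm h, hdet, Int.cast_one]

include hM hσ in
theorem exists_add_single_eq : ∃ (a : M) (b : Fin d → M),
    ∀ j, (a : Fin d → ℤ) + (Pi.single j 1 : Fin d → ℤ) = b j := by
  obtain ⟨a, ha, hab⟩ := exists_translate_mem hM hσ fun j : Fin d => (Pi.single j 1 : Fin d → ℤ)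
  exact ⟨⟨a, ha⟩, fun j => ⟨_, hab j⟩, fun j => rfl⟩

include hM hσ in
/-- Every linear map from `⋀^d Ω` to `K[ℤ^d]` is a multiple of `volumeCoeff`. -/
theorem exists_eq_mul_volumeCoeff
    (g : ⋀[MonoidRing K M]^d (Ω[MonoidRing K M⁄K]) →ₗ[MonoidRing K M] LaurentRing K d) :
    ∃ c, ∀ e, g e = c * volumeCoeff K M e := by
  obtain ⟨a, b, h⟩ := exists_add_single_eq hM hσ
  let θ := exteriorPower.ιMulti (MonoidRing K M) d fun j => logForm K a (b j)
  let c := g θ * AddMonoidAlgebra.single (-∑ j, ((a : Fin d → ℤ) + b j)) 1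
  refine ⟨c, fun e => ?_⟩
  have heq : g = (LinearMap.mulLeft (MonoidRing K M) c) ∘ₗ volumeCoeff K M := by
    refine exteriorPower.linearMap_ext (alternatingMap_ext_of_logForm hM hσ h ?_)
    change g θ = c * volumeCoeff K M θ
    rw [volumeCoeff_logForm h, mul_assoc, mul_comm (AddMonoidAlgebra.single _ _),
      single_mul_single_neg, mul_one]
  rw [heq]
  rfl

include hM hσ in
/-- Along the `i`-th facet there are forms which vanish only to first order: take a basis of `ℤ^d`
on which `σ_i` takes the values `1, 0, …, 0`. -/
theorem mem_latticeIdeal_of_forall_mul_volumeCoeff_mem {c : LaurentRing K d}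
    (h : ∀ e, c * volumeCoeff K M e ∈ latticeIdeal K M σ 0) : c ∈ latticeIdeal K M σ (-1) := by
  rw [mem_latticeIdeal hσ]
  intro z hz i
  obtain ⟨v, hv, hv1⟩ := exists_basis_sum_eq_one hσ i
  obtain ⟨a, ha, hai, hab⟩ := exists_translate_mem_of_nonneg hM hσ (fun j => v j) i hv
  let a' : M := ⟨a, ha⟩
  let b : Fin d → M := fun j => ⟨_, hab j⟩
  have hb : ∀ j, (a' : Fin d → ℤ) + v j = b j := fun j => rfl
  have hu : IsUnit (Matrix.of fun j => v j).det := by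
    have := (Pi.basisFun ℤ (Fin d)).isUnit_det v
    rw [Module.Basis.det_apply, ← Matrix.det_transpose] at this
    exact this
  have hk : (((Matrix.of fun j => v j).det : ℤ) : K) ≠ 0 := by
    rcases Int.isUnit_iff.1 hu with h | h <;> simp [h]
  have h1 := (mem_latticeIdeal hσ).1
    (h (exteriorPower.ιMulti (MonoidRing K M) d fun j => logForm K a' (b j)))
    (z + ∑ j, ((a' : Fin d → ℤ) + b j)) (by
      rw [volumeCoeff_ιMulti, logDet_logForm hb, AddMonoidAlgebra.coeff_mul_single_apply,
        add_neg_cancel_right]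
      exact mul_ne_zero hz hk) i
  have h2 : ∀ j, σ.mulVec ((a' : Fin d → ℤ) + b j) i = σ.mulVec (v j) i := fun j => by
    rw [← hb, Matrix.mulVec_add, Matrix.mulVec_add]
    change σ.mulVec a i + (σ.mulVec a i + _) = _
    rw [hai, zero_add, zero_add]
  rw [Matrix.mulVec_add, Matrix.mulVec_sum, Pi.add_apply, Finset.sum_apply,
    Finset.sum_congr rfl fun j _ => h2 j, hv1] at h1
  change -1 ≤ _
  change 0 ≤ _ at h1
  linarith

include hM hσ in
/-- Criterion for the dual of a module of rank one to be a lattice ideal: every linear map into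
`K[ℤ^d]` is a multiple of a given `φ`, and the multiples with values in `K[M]` are those by
elements of the ideal. -/
theorem nonempty_dual_equiv {N : Type*} [AddCommGroup N] [Module (MonoidRing K M) N]
    (φ : N →ₗ[MonoidRing K M] LaurentRing K d) {u : Fin s → ℤ} (hne : ∃ n, φ n ≠ 0)
    (hex : ∀ g : N →ₗ[MonoidRing K M] LaurentRing K d, ∃ c, ∀ n, g n = c * φ n)
    (hu : ∀ c, c ∈ latticeIdeal K M σ u ↔ ∀ n, c * φ n ∈ latticeIdeal K M σ 0) :
    Nonempty (Module.Dual (MonoidRing K M) N ≃ₗ[MonoidRing K M] latticeIdeal K M σ u) := by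
  -- Both sides are identified with the maps `N → K[ℤ^d]` that have values in `K[M]`.
  let α : Module.Dual (MonoidRing K M) N →ₗ[MonoidRing K M]
      (N →ₗ[MonoidRing K M] LaurentRing K d) :=
    LinearMap.compRight (MonoidRing K M) (Algebra.linearMap (MonoidRing K M) (LaurentRing K d))
  let β : latticeIdeal K M σ u →ₗ[MonoidRing K M] (N →ₗ[MonoidRing K M] LaurentRing K d) :=
    (LinearMap.lcomp (MonoidRing K M) (LaurentRing K d) φ) ∘ₗ
      (LinearMap.mul (MonoidRing K M) (LaurentRing K d)) ∘ₗ (latticeIdeal K M σ u).subtype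
  have hα : ∀ f n, α f n = algebraMap _ _ (f n) := fun f n => rfl
  have hβ : ∀ c n, β c n = c * φ n := fun c n => rfl
  have hαinj : Function.Injective α := fun f g hfg => LinearMap.ext fun n =>
    algebraMap_laurent_injective (by rw [← hα, ← hα, hfg])
  have hβinj : Function.Injective β := fun c c' h => Subtype.ext (by
    obtain ⟨n, hn⟩ := hne
    refine mul_right_cancel₀ hn ?_
    rw [← hβ, ← hβ, h])
  have hrange : LinearMap.range α = LinearMap.range β := by
    refine le_antisymm ?_ ?_
    · rintro _ ⟨f, rfl⟩
      obtain ⟨c, hc⟩ := hex (α f)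
      refine ⟨⟨c, (hu c).2 fun n => ?_⟩, LinearMap.ext fun n => ?_⟩
      · rw [← hc, mem_latticeIdeal_zero hM hσ]
        exact ⟨f n, rfl⟩
      · rw [hβ, hc]
    · rintro _ ⟨c, rfl⟩
      have hc : ∀ n, ∃ r, algebraMap (MonoidRing K M) (LaurentRing K d) r = c * φ n :=
        fun n => (mem_latticeIdeal_zero hM hσ).1 ((hu c).1 c.2 n)
      choose f hf using hc
      refine ⟨⟨⟨f, fun x y => algebraMap_laurent_injective ?_⟩,
        fun r x => algebraMap_laurent_injective ?_⟩, LinearMap.ext fun n => ?_⟩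
      · rw [map_add, hf, hf, hf, map_add, mul_add]
      · rw [smul_eq_mul, map_mul, hf, hf, map_smul, Algebra.smul_def, RingHom.id_apply]
        ring
      · rw [hβ, ← hf]; rfl
  exact ⟨(LinearEquiv.ofInjective α hαinj).trans ((LinearEquiv.ofEq _ _ hrange).trans
    (LinearEquiv.ofInjective β hβinj).symm)⟩

include hM hσ in
/-- The dual of `𝒟(u)` is `𝒟(-u)`. -/
theorem nonempty_dual_latticeIdeal_equiv (u : Fin s → ℤ) :
    Nonempty (Module.Dual (MonoidRing K M) (latticeIdeal K M σ u) ≃ₗ[MonoidRing K M]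
      latticeIdeal K M σ (-u)) := by
  have hL := isLocalization_laurentRing K hM hσ
  obtain ⟨z, hz⟩ := exists_le_mulVec hM hσ u
  let ξ : latticeIdeal K M σ u := ⟨_, single_mem_latticeIdeal hσ hz⟩
  refine nonempty_dual_equiv hM hσ (latticeIdeal K M σ u).subtype ⟨ξ, single_ne_zero' z⟩
    (fun g => ⟨g ξ * AddMonoidAlgebra.single (-z) 1, fun f => ?_⟩) fun c =>
    ⟨fun hc f => ?_, fun hc => ?_⟩
  · obtain ⟨⟨p, q⟩, hp⟩ := IsLocalization.surj (monomials K M)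
      ((f : LaurentRing K d) * AddMonoidAlgebra.single (-z) 1)
    have h1 : (q : MonoidRing K M) • f = p • ξ := Subtype.ext (by
      change (q : MonoidRing K M) • (f : LaurentRing K d) = p • AddMonoidAlgebra.single z 1
      rw [Algebra.smul_def, Algebra.smul_def]
      linear_combination (AddMonoidAlgebra.single z 1) * hp -
        f * algebraMap (MonoidRing K M) (LaurentRing K d) q * single_mul_single_neg (K := K) z)
    have h2 := congrArg g h1
    rw [map_smul, map_smul, Algebra.smul_def, Algebra.smul_def, ← hp] at h2
    refine (IsLocalization.map_units (LaurentRing K d) q).mul_left_cancel (h2.trans ?_)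
    rw [Submodule.subtype_apply]
    ring
  · have := mul_mem_latticeIdeal hσ hc f.2
    rwa [neg_add_cancel] at this
  · rw [← zero_sub]
    exact mem_latticeIdeal_of_forall_mul_single_mem hM hσ fun w hw =>
      hc ⟨_, single_mem_latticeIdeal hσ hw⟩

include hM hσ in
variable (K) in
/-- The canonical module is the ideal generated by the monomials in the interior of the cone. -/
theorem nonempty_canonicalModule_equiv :
    Nonempty (CanonicalModule K M ≃ₗ[MonoidRing K M] latticeIdeal K M σ 1) := by
  obtain ⟨e⟩ := nonempty_dual_equiv (u := -1) hM hσ (volumeCoeff K M) (by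
      obtain ⟨a, b, h⟩ := exists_add_single_eq hM hσ
      exact ⟨_, by rw [volumeCoeff_logForm h]; exact single_ne_zero' _⟩)
    (exists_eq_mul_volumeCoeff hM hσ) fun c => ⟨fun hc n => by
      have := mul_mem_latticeIdeal hσ hc (volumeCoeff_mem hM hσ n)
      rwa [neg_add_cancel] at this,
      mem_latticeIdeal_of_forall_mul_volumeCoeff_mem hM hσ⟩
  obtain ⟨e'⟩ := nonempty_dual_latticeIdeal_equiv (K := K) hM hσ (-1)
  rw [neg_neg] at e'
  exact ⟨e.symm.dualMap.trans e'⟩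

end Canonical

/-! ### The polytope of conic classes -/

section Conic

variable {K : Type*} [Field K] {d s : ℕ} {M : AddSubmonoid (Fin d → ℤ)}
  {σ : Matrix (Fin s) (Fin d) ℤ}

variable (σ) in
/-- The componentwise ceiling of `σ(y)`; the conic ideal `𝒞(y)` is `𝒟(⌈σ(y)⌉)`. -/
def ceilVec (y : Fin d → ℝ) : Fin s → ℤ := fun i => ⌈realMap σ y i⌉

variable (hM : IsPositiveNormalAffine M) (hσ : IsIrredundantRepresentation M σ)

variable (K) in
include hσ in
theorem conicIdeal_eq (y : Fin d → ℝ) : conicIdeal K M y = latticeIdeal K M σ (ceilVec σ y) := by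
  refine congrArg (monomialIdeal K M) (Set.ext fun x => ?_)
  rw [Set.mem_ofPred_eq, Set.mem_ofPred_eq, hσ.mem_iff, realMap_realVec, realVec_le, Pi.le_def]
  refine forall_congr' fun i => ?_
  rw [ceilVec, Int.ceil_le, map_sub, Pi.sub_apply, sub_nonneg, realMap_realVec]
  rfl

theorem ceilVec_add_realVec (y : Fin d → ℝ) (z : Fin d → ℤ) :
    ceilVec σ (y + realVec z) = ceilVec σ y + σ.mulVec z := by
  funext i
  rw [ceilVec, map_add, Pi.add_apply, realMap_realVec]
  exact Int.ceil_add_intCast _ _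

theorem finite_range_ceilVec_Icc :
    {u | ∃ y : Fin d → ℝ, (∀ k, 0 ≤ y k ∧ y k ≤ 1) ∧ ceilVec σ y = u}.Finite := by
  refine (Set.finite_Icc (fun i => -∑ k, |σ i k|) (fun i => ∑ k, |σ i k|)).subset ?_
  rintro _ ⟨y, hy, rfl⟩
  have h : ∀ i, |realMap σ y i| ≤ ((∑ k, |σ i k| : ℤ) : ℝ) := fun i => by
    rw [realMap_apply]
    push_cast
    refine (Finset.abs_sum_le_sum_abs _ _).trans (Finset.sum_le_sum fun k _ => ?_)
    rw [abs_mul, abs_of_nonneg (hy k).1]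
    exact mul_le_of_le_one_right (abs_nonneg _) (hy k).2
  refine ⟨fun i => ?_, fun i => Int.ceil_le.2 (abs_le.1 (h i)).2⟩
  have h1 := ((abs_le.1 (h i)).1).trans (Int.le_ceil _)
  exact_mod_cast h1

theorem exists_pos_forall_mul_lt {δ μ : Fin s → ℝ} (hδ : ∀ i, 0 < δ i) :
    ∃ ε : ℝ, 0 < ε ∧ ∀ i, ε * μ i < δ i := by
  have h : ∀ᶠ ε in nhdsWithin (0 : ℝ) (Set.Ioi 0), 0 < ε ∧ ∀ i, ε * μ i < δ i := by
    refine (eventually_mem_nhdsWithin).and (Filter.eventually_all.2 fun i => ?_)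
    have ht : Filter.Tendsto (fun ε : ℝ => ε * μ i) (nhdsWithin 0 (Set.Ioi 0)) (nhds (0 * μ i)) :=
      ((continuous_id.mul continuous_const).tendsto 0).mono_left nhdsWithin_le_nhds
    rw [zero_mul] at ht
    exact ht.eventually_lt_const (hδ i)
  exact h.exists

include hM hσ in
/-- Moving a point slightly into the cone turns `⌈·⌉` into `⌊·⌋ + 1`. -/
theorem exists_ceilVec_eq_floor_add_one (y : Fin d → ℝ) :
    ∃ y', ∀ i, ceilVec σ y' i = ⌊realMap σ y i⌋ + 1 := by
  obtain ⟨m, hm⟩ := exists_interior hM hσ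
  obtain ⟨ε, hε, h⟩ := exists_pos_forall_mul_lt (δ := fun i => 1 - Int.fract (realMap σ y i))
    (μ := fun i => (σ.mulVec m i : ℝ)) fun i => sub_pos.2 (Int.fract_lt_one _)
  refine ⟨y + ε • realVec m, fun i => ?_⟩
  have h1 := h i
  have h2 : 0 < ε * (σ.mulVec m i : ℝ) := mul_pos hε (by exact_mod_cast hm i)
  have h3 := Int.floor_add_fract (realMap σ y i)
  have h4 := Int.fract_nonneg (realMap σ y i)
  rw [ceilVec, map_add, map_smul, Pi.add_apply, Pi.smul_apply, realMap_realVec, smul_eq_mul]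
  change ⌈_ + ε * (σ.mulVec m i : ℝ)⌉ = _
  rw [Int.ceil_eq_iff]
  push_cast
  constructor <;> linarith

include hM hσ in
theorem exists_ceilVec_eq_one_sub (y : Fin d → ℝ) : ∃ y', ceilVec σ y' = 1 - ceilVec σ y := by
  obtain ⟨y', hy'⟩ := exists_ceilVec_eq_floor_add_one hM hσ (-y)
  refine ⟨y', funext fun i => ?_⟩
  rw [hy', map_neg, Pi.neg_apply, Int.floor_neg, Pi.sub_apply, Pi.one_apply, ceilVec]
  ring

include hM hσ in
/-- A point close to the origin in the relative interior of the `i`-th facet. -/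
theorem exists_ceilVec_eq_one_sub_single (i : Fin s) :
    ∃ y, ceilVec σ y = 1 - Pi.single i 1 := by
  obtain ⟨m, hmi, hmj⟩ := exists_facet_interior hM hσ i
  obtain ⟨ε, hε, h⟩ := exists_pos_forall_mul_lt (δ := fun _ => (1 : ℝ))
    (μ := fun i => (σ.mulVec m i : ℝ)) fun i => one_pos
  refine ⟨ε • realVec m, funext fun j => ?_⟩
  rw [ceilVec, map_smul, Pi.smul_apply, realMap_realVec, smul_eq_mul, Pi.sub_apply, Pi.one_apply]
  change ⌈ε * (σ.mulVec m j : ℝ)⌉ = _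
  by_cases hj : j = i
  · subst hj
    simp [hmi]
  · rw [Pi.single_eq_of_ne hj, sub_zero, Int.ceil_eq_iff]
    have h1 := h j
    have h2 : 0 < ε * (σ.mulVec m j : ℝ) := mul_pos hε (by exact_mod_cast hmj j hj)
    push_cast
    constructor <;> linarith

variable (σ) in
/-- The images in `ℝ^s / σ(ℝ^d)` of the vectors `⌈σ(y)⌉`. -/
def conicPoints : Set ((Fin s → ℝ) ⧸ LinearMap.range (realMap σ)) :=
  Set.range fun y => Submodule.Quotient.mk (realVec (ceilVec σ y))

/-- The conic points lie in the image of the half-open unit cube. -/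
theorem convexHull_conicPoints_subset : convexHull ℝ (conicPoints σ) ⊆
    (LinearMap.range (realMap σ)).mkQ '' Set.univ.pi fun _ => Set.Ico 0 1 := by
  refine convexHull_min ?_ ((convex_pi fun _ _ => convex_Ico 0 1).linear_image _)
  rintro _ ⟨y, rfl⟩
  refine ⟨realVec (ceilVec σ y) - realMap σ y, fun i _ => ?_, ?_⟩
  · rw [Pi.sub_apply]
    change (⌈realMap σ y i⌉ : ℝ) - realMap σ y i ∈ _
    exact ⟨sub_nonneg.2 (Int.le_ceil _), by linarith [Int.ceil_lt_add_one (realMap σ y i)]⟩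
  · have h0 : (LinearMap.range (realMap σ)).mkQ (realMap σ y) = 0 :=
      (Submodule.Quotient.mk_eq_zero _).2 (LinearMap.mem_range_self _ y)
    rw [map_sub, h0, sub_zero]
    rfl

/-- An integral point of the convex hull is itself a conic point. -/
theorem exists_ceilVec_eq {u : Fin s → ℤ}
    (hu : Submodule.Quotient.mk (realVec u) ∈ convexHull ℝ (conicPoints σ)) :
    ∃ y, ceilVec σ y = u := by
  obtain ⟨q, hq, hqu⟩ := convexHull_conicPoints_subset hu
  obtain ⟨y, hy⟩ := (Submodule.Quotient.eq _).1 hqu.symm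
  refine ⟨y, funext fun i => ?_⟩
  have h1 := hq i trivial
  rw [ceilVec, Int.ceil_eq_iff, hy, Pi.sub_apply]
  change (u i : ℝ) - 1 < (u i : ℝ) - q i ∧ (u i : ℝ) - q i ≤ u i
  exact ⟨by linarith [h1.2], by linarith [h1.1]⟩

theorem realVec_sub {n : ℕ} (x y : Fin n → ℤ) : realVec (x - y) = realVec x - realVec y := by
  funext i
  simp [realVec]

include hM hσ in
theorem pointReflection_image_conicPoints :
    AffineEquiv.pointReflection ℝ
      ((1 / 2 : ℝ) • (Submodule.Quotient.mk (realVec 1) :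
        (Fin s → ℝ) ⧸ LinearMap.range (realMap σ))) '' conicPoints σ = conicPoints σ := by
  have h : ∀ v ∈ conicPoints σ, AffineEquiv.pointReflection ℝ
      ((1 / 2 : ℝ) • (Submodule.Quotient.mk (realVec 1) :
        (Fin s → ℝ) ⧸ LinearMap.range (realMap σ))) v ∈ conicPoints σ := by
    rintro _ ⟨y, rfl⟩
    obtain ⟨y', hy'⟩ := exists_ceilVec_eq_one_sub hM hσ y
    refine ⟨y', ?_⟩
    simp only [hy', realVec_sub, Submodule.Quotient.mk_sub, AffineEquiv.pointReflection_apply,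
      vsub_eq_sub, vadd_eq_add]
    module
  refine Set.Subset.antisymm (Set.image_subset_iff.2 h) fun v hv => ⟨_, h v hv, ?_⟩
  exact AffineEquiv.pointReflection_involutive ℝ _ v

include hM hσ in
theorem vectorSpan_conicPoints : vectorSpan ℝ (conicPoints σ) = ⊤ := by
  rw [eq_top_iff]
  intro v _
  obtain ⟨x, rfl⟩ := Submodule.Quotient.mk_surjective _ v
  have he : ∀ i, (Submodule.Quotient.mk (Pi.single i 1) :
      (Fin s → ℝ) ⧸ LinearMap.range (realMap σ)) ∈ vectorSpan ℝ (conicPoints σ) := fun i => by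
    obtain ⟨y, hy⟩ := exists_ceilVec_eq_one_sub hM hσ 0
    obtain ⟨y', hy'⟩ := exists_ceilVec_eq_one_sub_single hM hσ i
    have h := vsub_mem_vectorSpan ℝ (s := conicPoints σ) ⟨y, rfl⟩ ⟨y', rfl⟩
    convert h using 1
    simp only [vsub_eq_sub, ← Submodule.Quotient.mk_sub, ← realVec_sub, hy, hy']
    congr 1
    funext j
    have h0 : ceilVec σ 0 = 0 := funext fun i => by simp [ceilVec]
    simp only [h0, realVec, Pi.single_apply, Pi.sub_apply, Pi.one_apply, Pi.zero_apply]
    split_ifs <;> simp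
  have hx : x = ∑ i, x i • (Pi.single i 1 : Fin s → ℝ) := by
    conv_lhs => rw [← Finset.univ_sum_single x]
    exact Finset.sum_congr rfl fun i _ => by rw [← Pi.single_smul, smul_eq_mul, mul_one]
  rw [hx]
  change (LinearMap.range (realMap σ)).mkQ _ ∈ _
  rw [map_sum]
  refine Submodule.sum_mem _ fun i _ => ?_
  rw [map_smul]
  exact Submodule.smul_mem _ _ (he i)

include hM hσ in
theorem finrank_quotient_range_add :
    Module.finrank ℝ ((Fin s → ℝ) ⧸ LinearMap.range (realMap σ)) + d = s := by
  have h := Submodule.finrank_quotient_add_finrank (LinearMap.range (realMap σ))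
  rw [LinearMap.finrank_range_of_inj (realMap_injective hM hσ)] at h
  simpa using h

variable (K) in
/-- Modulo torsion, the divisor class group embeds into `ℝ^s / σ(ℝ^d)`. -/
theorem exists_classEmbedding [IsLocalization (monomials K M) (LaurentRing K d)] :
    ∃ ι : DivisorClassGroup (MonoidRing K M) ⧸
        AddCommGroup.torsion (DivisorClassGroup (MonoidRing K M)) →+
      (Fin s → ℝ) ⧸ LinearMap.range (realMap σ),
      Function.Injective ι ∧ ∀ u, ι (QuotientAddGroup.mk (latticeClass K hM hσ u)) =
        Submodule.Quotient.mk (realVec u) := by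
  let ψ : (Fin s → ℤ) →+ (Fin s → ℝ) ⧸ LinearMap.range (realMap σ) :=
    AddMonoidHom.mk' (fun u => Submodule.Quotient.mk (realVec u)) fun u v => by
      rw [realVec_add, Submodule.Quotient.mk_add]
  have hψ : (latticeClass K hM hσ).ker ≤ ψ.ker := fun u hu => by
    obtain ⟨z, rfl⟩ := exists_mulVec_eq_of_latticeClass_eq_zero hM hσ hu
    refine (Submodule.Quotient.mk_eq_zero _).2 ⟨realVec z, realMap_realVec z⟩
  let κ := (latticeClass K hM hσ).liftOfSurjective (latticeClass_surjective hM hσ) ⟨ψ, hψ⟩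
  have hκ : ∀ u, κ (latticeClass K hM hσ u) = Submodule.Quotient.mk (realVec u) := fun u =>
    AddMonoidHom.liftOfRightInverse_comp_apply _ _ _ ⟨ψ, hψ⟩ u
  have hT : AddCommGroup.torsion (DivisorClassGroup (MonoidRing K M)) ≤ κ.ker := by
    intro c hc
    obtain ⟨n, hn, hnc⟩ := isOfFinAddOrder_iff_nsmul_eq_zero.1 hc
    have h := congrArg κ hnc
    rw [map_nsmul, map_zero, ← Nat.cast_smul_eq_nsmul ℝ, smul_eq_zero] at h
    exact h.resolve_left (by exact_mod_cast hn.ne')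
  refine ⟨QuotientAddGroup.lift _ κ hT, ?_, hκ⟩
  rw [injective_iff_map_eq_zero]
  intro q hq
  obtain ⟨c, rfl⟩ := QuotientAddGroup.mk_surjective q
  obtain ⟨u, rfl⟩ := latticeClass_surjective hM hσ c
  have h0 : (Submodule.Quotient.mk (realVec u) : (Fin s → ℝ) ⧸ LinearMap.range (realMap σ)) = 0 :=
    (hκ u).symm.trans hq
  obtain ⟨y, hy⟩ := (Submodule.Quotient.mk_eq_zero _).1 h0
  obtain ⟨n, z, hn, hz⟩ := exists_nsmul_eq_mulVec hy.symm
  rw [QuotientAddGroup.eq_zero_iff]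
  refine isOfFinAddOrder_iff_nsmul_eq_zero.2 ⟨n, hn, ?_⟩
  rw [← map_nsmul, hz, latticeClass_mulVec]

theorem isConicClass_iff [IsLocalization (monomials K M) (LaurentRing K d)]
    {c : DivisorClassGroup (MonoidRing K M)} :
    IsConicClass K M c ↔ ∃ y, latticeClass K hM hσ (ceilVec σ y) = c := by
  refine exists_congr fun y => ?_
  rw [conicIdeal_eq K hσ]
  constructor
  · exact fun h => (hasDivisorClass_latticeIdeal hM hσ _).unique h
  · rintro rfl
    exact hasDivisorClass_latticeIdeal hM hσ _

theorem finite_isConicClass [IsLocalization (monomials K M) (LaurentRing K d)]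
    (hM : IsPositiveNormalAffine M) (hσ : IsIrredundantRepresentation M σ) :
    {c | IsConicClass K M c}.Finite := by
  refine ((finite_range_ceilVec_Icc (σ := σ)).image (latticeClass K hM hσ)).subset ?_
  intro c hc
  obtain ⟨y, rfl⟩ := (isConicClass_iff hM hσ).1 hc
  -- translations by lattice points do not change the class
  have hy : y = (fun k => Int.fract (y k)) + realVec fun k => ⌊y k⌋ :=
    funext fun k => (Int.fract_add_floor (y k)).symm
  refine ⟨_, ⟨fun k => Int.fract (y k), fun k => ⟨Int.fract_nonneg _, (Int.fract_lt_one _).le⟩,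
    rfl⟩, ?_⟩
  conv_rhs => rw [hy, ceilVec_add_realVec, map_add, latticeClass_mulVec, add_zero]

end Conic

end

theorem mainTheorem6 {K : Type*} [Field K] {d s : ℕ} (M : AddSubmonoid (Fin d → ℤ))
    (hM : IsPositiveNormalAffine M) (σ : Matrix (Fin s) (Fin d) ℤ)
    (hσ : IsIrredundantRepresentation M σ) :
    -- the identification of `Cl(R)/T` with the lattice of integral points in `ℝ^s / σ(ℝ^d)`
    ∃ ι : DivisorClassGroup (MonoidRing K M) ⧸
        AddCommGroup.torsion (DivisorClassGroup (MonoidRing K M)) →+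
      (Fin s → ℝ) ⧸ LinearMap.range (realMap σ),
      Function.Injective ι ∧
      (∀ u : Fin s → ℤ, ∃ c : DivisorClassGroup (MonoidRing K M),
        HasDivisorClass (divisorialMonomialIdeal K M σ (realVec u)) c) ∧
      (∀ c : DivisorClassGroup (MonoidRing K M), ∃ u : Fin s → ℤ,
        HasDivisorClass (divisorialMonomialIdeal K M σ (realVec u)) c) ∧
      (∀ (u : Fin s → ℤ) (c : DivisorClassGroup (MonoidRing K M)),
        HasDivisorClass (divisorialMonomialIdeal K M σ (realVec u)) c →
          ι (QuotientAddGroup.mk c) = Submodule.Quotient.mk (realVec u)) ∧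
      -- `P` is a nonempty polytope
      {c | IsConicClass K M c}.Finite ∧
      (conicPolytope K M σ ι).Nonempty ∧
      -- a class is conic iff its residue class modulo `T` lies in `P`
      (∀ c, IsConicClass K M c ↔ ι (QuotientAddGroup.mk c) ∈ conicPolytope K M σ ι) ∧
      -- `dim P = s - d`, and `P` is centrally symmetric about `[ω]/2`
      Module.finrank ℝ (affineSpan ℝ (conicPolytope K M σ ι)).direction + d = s ∧
      ∃ w : DivisorClassGroup (MonoidRing K M), HasDivisorClass (CanonicalModule K M) w ∧
        AffineEquiv.pointReflection ℝ ((1 / 2 : ℝ) • ι (QuotientAddGroup.mk w)) ''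
          conicPolytope K M σ ι = conicPolytope K M σ ι := by
  have hL := isLocalization_laurentRing K hM hσ
  obtain ⟨ι, hι, hιu⟩ := exists_classEmbedding K hM hσ
  have hpts : {v | ∃ c, IsConicClass K M c ∧ ι (QuotientAddGroup.mk c) = v} = conicPoints σ := by
    ext v
    constructor
    · rintro ⟨c, hc, rfl⟩
      obtain ⟨y, rfl⟩ := (isConicClass_iff hM hσ).1 hc
      exact ⟨y, (hιu _).symm⟩
    · rintro ⟨y, rfl⟩
      exact ⟨_, (isConicClass_iff hM hσ).2 ⟨y, rfl⟩, hιu _⟩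
  have hP : conicPolytope K M σ ι = convexHull ℝ (conicPoints σ) := congrArg (convexHull ℝ) hpts
  refine ⟨ι, hι, fun u => ⟨_, hasDivisorClass_latticeIdeal hM hσ u⟩, fun c => ?_, fun u c hc => ?_,
    finite_isConicClass hM hσ, ?_, fun c => ?_, ?_, latticeClass K hM hσ 1, ?_, ?_⟩
  · obtain ⟨u, rfl⟩ := latticeClass_surjective hM hσ c
    exact ⟨u, hasDivisorClass_latticeIdeal hM hσ u⟩
  · rw [hc.unique (hasDivisorClass_latticeIdeal hM hσ u), hιu]
  · rw [hP]
    exact Set.Nonempty.convexHull ⟨_, 0, rfl⟩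
  · obtain ⟨u, rfl⟩ := latticeClass_surjective hM hσ c
    rw [hP]
    constructor
    · rintro hc
      rw [← hP]
      exact subset_convexHull ℝ _ ⟨_, hc, rfl⟩
    · intro h
      rw [hιu] at h
      obtain ⟨y, rfl⟩ := exists_ceilVec_eq h
      exact (isConicClass_iff hM hσ).2 ⟨y, rfl⟩
  · rw [hP, affineSpan_convexHull, direction_affineSpan, vectorSpan_conicPoints hM hσ, finrank_top]
    exact finrank_quotient_range_add hM hσ
  · obtain ⟨e⟩ := nonempty_canonicalModule_equiv K hM hσ
    exact (hasDivisorClass_latticeIdeal hM hσ 1).congr e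
  · rw [hP, hιu]
    refine (AffineMap.image_convexHull (AffineEquiv.toAffineMap
      (AffineEquiv.pointReflection ℝ _)) _).trans ?_
    exact congrArg _ (pointReflection_image_conicPoints hM hσ)
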